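/- Let $G=(\mathcal V,\mathcal E)$ be a finite connected simple graph and let $\mathbb W$ be the set of finite words over $\mathcal V$ that do not contain two letters adjacent in $G$; $\mathbb W_2\subset\mathbb W$ is the set of those of even length, and $\emptyset$ is the empty word. Let $\mathcal S$ be the finite set of lists of preferences, i.e. of families $\sigma=(\sigma(v))_{v\in\mathcal V}$ where $\sigma(v)$ is a permutation of the set of neighbours of $v$. An *admissible matching policy* $\phi$ consists of a probability law $\nu_\phi$ on $\mathcal S$ and a map $\odot_\phi:\mathbb W\times(\mathcal V\times\mathcal S)\to\mathbb W$ such that $w\odot_\phi(v,\sigma)=wv$ if no letter of $w$ is adjacent to $v$, and otherwise $w\odot_\phi(v,\sigma)$ is obtained from $w$ by deleting one letter adjacent to $v$. For $z=v_1\dots v_q\in\mathcal V^*$ and $\varsigma=\sigma_1\dots\sigma_q\in\mathcal S^*$ put $W_\phi(z,\varsigma)=(\cdots(\emptyset\odot_\phi(v_1,\sigma_1))\cdots)\odot_\phi(v_q,\sigma_q)$. The policy is *sub-additive* if $|W_\phi(z'z'',\varsigma'\varsigma'')|\le|W_\phi(z',\varsigma')|+|W_\phi(z'',\varsigma'')|$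 for all words $z',z''$ over $\mathcal V$ and all words $\varsigma',\varsigma''$ of the respective same lengths over the support of $\nu_\phi$. Let $\mu$ be a probability measure on $\mathcal V$ with full support. Let $\Omega^0=(\mathcal V\times\mathcal S\times\mathcal V\times\mathcal S)^{\mathbb Z}$ carry the product $\sigma$-algebra and the law $\mathbb P$ under which the coordinates are i.i.d. with law $\mu\otimes\nu_\phi\otimes\mu\otimes\nu_\phi$; let $\theta$ be the shift, $\theta((\omega_n)_n)=(\omega_{n+1})_n$, and let $(V^0,\Sigma^0,V^1,\Sigma^1)$ be the coordinate at $0$. For a $\mathbb W_2$-valued random variable $Y$ on $\Omega^0$, the buffer content at even times started from $Y$ is $$U^{\{Y\}}_0=Y,\qquad U^{\{Y\}}_{n+1}=\bigl(U^{\{Y\}}_n\odot_\phi(V^0\circ\theta^n,\Sigma^0\circ\theta^n)\bigr)\odot_\phi(V^1\circ\theta^n,\Sigma^1\circ\theta^n),\quad n\ge0 .$$ **Theorem.** Suppose that $\phi$ is sub-additive and that the first return time to the empty state, $\tau_1(\emptyset)=\inf\{n>0: U^{\{\emptyset\}}_n=\emptyset\}\in\mathbb N\cup\{\infty\}$, satisfies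 $\mathbb E[\tau_1(\emptyset)]<\infty$. Then there is a $\mathbb W_2$-valued random variable $U$ on $\Omega^0$ such that, $\mathbb P$-almost surely, $$U\circ\theta=\bigl(U\odot_\phi(V^0,\Sigma^0)\bigr)\odot_\phi(V^1,\Sigma^1),$$ and every $\mathbb W_2$-valued random variable on $\Omega^0$ that satisfies this equation almost surely is almost surely equal to $U$. Moreover, for every $\mathbb W_2$-valued random variable $Y$ on $\Omega^0$ with $|Y|\le 2r$ almost surely for some constant $r\in\mathbb N$, the sequence $(U^{\{Y\}}_n)_{n\ge0}$ converges to $U$ with strong backwards coupling: $\mathbb P$-almost surely there is a finite $N^*$ such that $U^{\{Y\}}_n\circ\theta^{-n}=U$ for all $n\ge N^*$. -/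

import Mathlib

open MeasureTheory
open scoped ENNReal

noncomputable section

namespace StochasticMatching

variable {V : Type*} {G : SimpleGraph V}

/-- A list of preferences: for each class `v`, a permutation of the classes compatible with `v`. -/
def Prefs (G : SimpleGraph V) : Type _ := ∀ v : V, Equiv.Perm (G.neighborSet v)

instance : MeasurableSpace (Prefs G) := ⊤

instance : DiscreteMeasurableSpace (Prefs G) := ⟨fun _ => trivial⟩

/-- Queue details: finite words of classes, in order of arrival, that do not contain two
compatible letters. -/
def QueueDetail (G : SimpleGraph V) : Type _ :=
  {w : List V // ∀ i j : V, G.Adj i j → ¬ (i ∈ w ∧ j ∈ w)}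

/-- The empty word. -/
def QueueDetail.empty : QueueDetail G := ⟨[], by simp⟩

/-- Number of letters. -/
def QueueDetail.length (w : QueueDetail G) : ℕ := w.1.length

/-- An admissible (greedy) matching policy on `G`: the law on lists of preferences, together with
the action of an arrival `(v, σ)` on queue details. If no stored item is compatible with `v`, then
`v` joins the end of the queue; otherwise one stored item compatible with `v`, which is determined
by the queue detail and `(v, σ)`, is matched with `v` and leaves. -/
structure MatchingPolicy (G : SimpleGraph V) where
  /-- law of the lists of preferences -/
  prefLaw : PMF (Prefs G)
  /-- action of an arrival on the queue detail -/
  act : QueueDetail G → V × Prefs G → QueueDetail G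
  act_store : ∀ (w : QueueDetail G) (v : V) (σ : Prefs G),
    (∀ j ∈ w.1, ¬ G.Adj v j) → (act w (v, σ)).1 = w.1 ++ [v]
  act_match : ∀ (w : QueueDetail G) (v : V) (σ : Prefs G),
    (∃ j ∈ w.1, G.Adj v j) →
      ∃ (k : ℕ) (hk : k < w.1.length), G.Adj v (w.1[k]) ∧ (act w (v, σ)).1 = w.1.eraseIdx k

namespace MatchingPolicy

/-- The queue detail reached from an empty system after the arrivals `x`; a pair of words (classes
and lists of preferences) of equal length is encoded as a word of pairs. -/
def finalQueue (φ : MatchingPolicy G) (x : List (V × Prefs G)) : QueueDetail G :=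
  x.foldl φ.act QueueDetail.empty

/-- Sub-additivity, for lists of preferences that can be drawn from the law of the policy. -/
def SubAdditive (φ : MatchingPolicy G) : Prop :=
  ∀ x y : List (V × Prefs G),
    (∀ p ∈ x, p.2 ∈ φ.prefLaw.support) → (∀ p ∈ y, p.2 ∈ φ.prefLaw.support) →
      (φ.finalQueue (x ++ y)).length ≤ (φ.finalQueue x).length + (φ.finalQueue y).length

end MatchingPolicy

/-- Queue details of even length. -/
def EvenQueue (G : SimpleGraph V) : Type _ := {w : QueueDetail G // Even w.length}

instance : MeasurableSpace (EvenQueue G) := ⊤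

instance : DiscreteMeasurableSpace (EvenQueue G) := ⟨fun _ => trivial⟩

/-- The empty word. -/
def EvenQueue.empty : EvenQueue G := ⟨QueueDetail.empty, by
  simp [QueueDetail.length, QueueDetail.empty]⟩

/-- Number of letters. -/
def EvenQueue.length (u : EvenQueue G) : ℕ := u.1.length

namespace MatchingPolicy

theorem even_length_act (φ : MatchingPolicy G) (w : QueueDetail G) (p : V × Prefs G) :
    Even (φ.act w p).length ↔ ¬ Even w.length := by
  obtain ⟨v, σ⟩ := p
  by_cases h : ∃ j ∈ w.1, G.Adj v j
  · obtain ⟨k, hk, -, he⟩ := φ.act_match w v σ h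
    have h1 : (φ.act w (v, σ)).length + 1 = w.length := by
      unfold QueueDetail.length
      rw [he, List.length_eraseIdx_of_lt hk]
      omega
    rw [← h1, Nat.even_add_one, not_not]
  · have h2 := φ.act_store w v σ (fun j hj ha => h ⟨j, hj, ha⟩)
    have h1 : (φ.act w (v, σ)).length = w.length + 1 := by
      unfold QueueDetail.length
      rw [h2]
      simp
    rw [h1, Nat.even_add_one]

/-- The effect of two successive arrivals on the even buffer content. -/
def evenStep (φ : MatchingPolicy G) (u : EvenQueue G)
    (a : (V × Prefs G) × (V × Prefs G)) : EvenQueue G :=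
  ⟨φ.act (φ.act u.1 a.1) a.2, by
    rw [even_length_act, even_length_act, not_not]
    exact u.2⟩

end MatchingPolicy

/-- Bi-infinite inputs by pairs: `ω n` is the pair of arrivals `((V⁰, Σ⁰), (V¹, Σ¹)) ∘ θⁿ`. -/
abbrev InputPath (G : SimpleGraph V) : Type _ := ℤ → (V × Prefs G) × (V × Prefs G)

/-- The `k`-th iterate `θᵏ` of the shift, `k ∈ ℤ`. -/
def shift (k : ℤ) (ω : InputPath G) : InputPath G := fun n => ω (n + k)

namespace MatchingPolicy

section

variable [MeasurableSpace V]

/-- Law of a single arrival: class and list of preferences are independent. -/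
def itemLaw (φ : MatchingPolicy G) (μ : PMF V) : Measure (V × Prefs G) :=
  μ.toMeasure.prod φ.prefLaw.toMeasure

instance (φ : MatchingPolicy G) (μ : PMF V) : IsProbabilityMeasure (φ.itemLaw μ) := by
  unfold itemLaw
  infer_instance

/-- Law of the bi-infinite i.i.d. input, on the product σ-algebra. -/
def inputLaw (φ : MatchingPolicy G) (μ : PMF V) : Measure (InputPath G) :=
  Measure.infinitePi fun _ : ℤ => (φ.itemLaw μ).prod (φ.itemLaw μ)

end

/-- The even buffer content sequence started from the (random) value `Y`. -/
def evenContent (φ : MatchingPolicy G) (Y : InputPath G → EvenQueue G) :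
    ℕ → InputPath G → EvenQueue G
  | 0, ω => Y ω
  | n + 1, ω => φ.evenStep (φ.evenContent Y n ω) (ω n)

/-- First time `n > 0` at which the even buffer content started from `Y` is empty
(`⊤` if there is none). -/
def returnTime (φ : MatchingPolicy G) (Y : InputPath G → EvenQueue G) (ω : InputPath G) : ℕ∞ :=
  ⨅ (n : ℕ) (_ : 0 < n ∧ φ.evenContent Y n ω = EvenQueue.empty), (n : ℕ∞)

section

variable [MeasurableSpace V]

/-- The first return time to the empty state has finite expectation. -/
def ReturnIntegrable (φ : MatchingPolicy G) (μ : PMF V) : Prop :=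
  ∫⁻ ω, (φ.returnTime (fun _ => EvenQueue.empty) ω : ℝ≥0∞) ∂(φ.inputLaw μ) ≠ ∞

/-- `U` is a random variable, with values in the words of even length, that solves the stationary
equation `U ∘ θ = (U ⊙ (V⁰, Σ⁰)) ⊙ (V¹, Σ¹)` almost surely. -/
def IsStationarySolution (φ : MatchingPolicy G) (μ : PMF V) (U : InputPath G → EvenQueue G) :
    Prop :=
  Measurable U ∧ ∀ᵐ ω ∂(φ.inputLaw μ), U (shift 1 ω) = φ.evenStep (U ω) (ω 0)

/-- Almost surely, the content at time `0` of the system started from `Y` at time `-n` is equal to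
`U` for all large `n`. -/
def StrongBackwardsCoupling (φ : MatchingPolicy G) (μ : PMF V)
    (Y U : InputPath G → EvenQueue G) : Prop :=
  ∀ᵐ ω ∂(φ.inputLaw μ), ∃ N : ℕ, ∀ n : ℕ, N ≤ n →
    φ.evenContent Y n (shift (-(n : ℤ)) ω) = U ω

end

end MatchingPolicy

end StochasticMatching

end

/-!
Everything rests on *backward coalescence* (`MatchingPolicy.SubAdditive.ae_coalescence`): almost
surely, all the systems started far enough in the past from a queue of length at most `R` have the
same content at time `0`. The stationary solution is the common value. It is unique because, by
Poincaré recurrence, any solution is infinitely often in the past as short as it is at time `0`.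

Backward coalescence is a Loynes type argument. Cut the trajectory of the system started empty
into *cycles*, the words between two successive visits of the empty state. Sub-additivity says that
a cycle never lengthens a queue, whatever the queue it acts on, and from every nonempty queue some
sequence of `K` cycles of probability bounded below shortens it. So, for `|w|` the length of a
queue `w`, the potential `2 ^ |w|`, set to `0` at the empty queue, is contracted geometrically in
mean along independent cycles (`iterMean_potential_pow_le`). A queue of length at most `R`
introduced during a cycle `x` has length at most `R + 2 |x|` at the end of the cycle, hence all the
systems started during `x` are empty after `O(|x| + 1)` further cycles in mean
(`exists_tsum_list_le`).

The words on which this fails are the *late words* (`lateWords`). Their total weight is finite,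
because it is linear in the mean return time (`tsum_lateWords_ne_top`). By Borel–Cantelli, almost
surely only finitely many of the words `ω (-n), …, ω (-1)` are late, and a deterministic argument
(`foldl_eq_of_suffix`) then gives coalescence. Weights are summed over words with `tsum_mul_wt`,
which turns a sum over all words into an expectation; no stopping time is needed, and only
inequalities between sums of nonnegative terms.

Shortening sequences exist as soon as any two vertices are joined by a walk of odd length
(`MatchingPolicy.exists_edges_length_lt`): letting the two ends of an edge of the walk arrive either
shortens the queue or leaves two stored items joined by a shorter odd walk. A connected graph
without such walks is bipartite; then the difference between the numbers of stored items of the two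
colours is a nondegenerate random walk, and its return time to `0` would have a finite mean, which
is impossible (`increment_eq_zero_of_tsum_isExcursion_ne_top`).
-/

noncomputable section
namespace StochasticMatching

/-! ### Return words of a deterministic automaton -/

section Words

variable {A S : Type*} (step : S → A → S) (e : S)

/-- A word that does not bring the automaton back to its base state `e`, at any positive time. -/
def IsExcursion (x : List A) : Prop :=
  ∀ p, p <+: x → p ≠ [] → p.foldl step e ≠ e

/-- A first return word: it brings the automaton back to `e` for the first time at its end. -/
def IsCycle (x : List A) : Prop :=
  x ≠ [] ∧ x.foldl step e = e ∧ ∀ p, p <+: x → p ≠ [] → p ≠ x → p.foldl step e ≠ e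

variable {step e}

theorem isExcursion_nil : IsExcursion step e ([] : List A) := by
  intro p hp hne
  exact absurd (List.prefix_nil.1 hp) hne

theorem isCycle_singleton {a : A} (h : step e a = e) : IsCycle step e [a] := by
  refine ⟨by simp, by simpa using h, fun p hp hne hne' => ?_⟩
  rcases List.prefix_concat_iff (l₂ := []).1 hp with h | h
  · exact absurd h hne'
  · exact absurd (List.prefix_nil.1 h) hne

theorem IsExcursion.concat {x : List A} (hx : IsExcursion step e x) (a : A)
    (h : (x ++ [a]).foldl step e ≠ e) : IsExcursion step e (x ++ [a]) := by
  intro p hp hne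
  rcases List.prefix_concat_iff.1 hp with rfl | hp
  · exact h
  · exact hx p hp hne

theorem IsExcursion.concat_isCycle {x : List A} (hx : IsExcursion step e x) (a : A)
    (h : (x ++ [a]).foldl step e = e) : IsCycle step e (x ++ [a]) := by
  refine ⟨by simp, h, fun p hp hne hne' => ?_⟩
  rcases List.prefix_concat_iff.1 hp with rfl | hp
  · exact absurd rfl hne'
  · exact hx p hp hne

/-- The first return words, as an alphabet. -/
abbrev Cycle (step : S → A → S) (e : S) : Type _ := {x : List A // IsCycle step e x}

/-- Concatenation of first return words. -/
def joinCycles (L : List (Cycle step e)) : List A := (L.map Subtype.val).flatten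

@[simp]
theorem joinCycles_nil : joinCycles ([] : List (Cycle step e)) = [] := rfl

@[simp]
theorem joinCycles_cons (x : Cycle step e) (L : List (Cycle step e)) :
    joinCycles (x :: L) = x.1 ++ joinCycles L := rfl

@[simp]
theorem joinCycles_append (L L' : List (Cycle step e)) :
    joinCycles (L ++ L') = joinCycles L ++ joinCycles L' := by
  simp [joinCycles]

@[simp]
theorem foldl_joinCycles (L : List (Cycle step e)) : (joinCycles L).foldl step e = e := by
  induction L with
  | nil => rfl
  | cons x L ih => rw [joinCycles_cons, List.foldl_append, x.2.2.1, ih]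

/-- Decomposition of a word at its last return to the base state. -/
theorem exists_eq_joinCycles_append (z : List A) :
    ∃ (L : List (Cycle step e)) (x : List A), IsExcursion step e x ∧ z = joinCycles L ++ x := by
  induction z using List.reverseRecOn with
  | nil => exact ⟨[], [], isExcursion_nil, rfl⟩
  | append_singleton z a ih =>
    obtain ⟨L, x, hx, rfl⟩ := ih
    by_cases h : (x ++ [a]).foldl step e = e
    · exact ⟨L ++ [⟨x ++ [a], hx.concat_isCycle a h⟩], [], isExcursion_nil, by simp⟩
    · exact ⟨L, x ++ [a], hx.concat a h, by simp⟩

/-- A nonempty suffix of a concatenation of cycles starts inside one of the cycles. -/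
theorem exists_of_suffix_joinCycles (L : List (Cycle step e)) (s : List A) (hs : s ≠ [])
    (h : s <:+ joinCycles L) :
    ∃ (x : Cycle step e) (L' : List (Cycle step e)) (s' : List A),
      s' <:+ x.1 ∧ s = s' ++ joinCycles L' ∧ x.1 ++ joinCycles L' <:+ joinCycles L := by
  induction L with
  | nil => exact absurd (List.suffix_nil.1 h) hs
  | cons x L ih =>
    rw [joinCycles_cons] at h
    rcases le_total s.length (joinCycles L).length with hl | hl
    · obtain ⟨y, L', s', h1, h2, h3⟩ :=
        ih (List.suffix_of_suffix_length_le h (List.suffix_append _ _) hl)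
      exact ⟨y, L', s', h1, h2, h3.trans (List.suffix_append _ _)⟩
    · obtain ⟨s', rfl⟩ := List.suffix_of_suffix_length_le (List.suffix_append _ _) h hl
      exact ⟨x, L, s', (List.suffix_append_inj_of_length_eq rfl |>.1 h |>.1), rfl, List.suffix_rfl⟩

end Words

/-! ### Weights of words and the law of a window of letters -/

section Weights

variable {α : Type*} (q : α → ℝ≥0∞)

/-- Weight of a word: the product of the weights of its letters. -/
def wt (x : List α) : ℝ≥0∞ := (x.map q).prod

@[simp] theorem wt_nil : wt q [] = 1 := rfl

@[simp] theorem wt_cons (a : α) (x : List α) : wt q (a :: x) = q a * wt q x := by simp [wt]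

@[simp] theorem wt_append (x y : List α) : wt q (x ++ y) = wt q x * wt q y := by simp [wt]

theorem wt_ofFn {n : ℕ} (v : Fin n → α) : wt q (List.ofFn v) = ∏ i, q (v i) := by
  simp [wt, List.map_ofFn, List.prod_ofFn]

theorem tsum_list {β : Type*} (f : List β → ℝ≥0∞) :
    ∑' x, f x = ∑' (n : ℕ) (v : Fin n → β), f (List.ofFn v) := by
  rw [← List.equivSigmaTuple.symm.tsum_eq, ENNReal.tsum_sigma']
  rfl

theorem tsum_ofFn_succ {β : Type*} (n : ℕ) (f : List β → ℝ≥0∞) :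
    ∑' v : Fin (n + 1) → β, f (List.ofFn v) =
      ∑' (b : β) (v : Fin n → β), f (b :: List.ofFn v) := by
  rw [← (Fin.consEquiv fun _ => β).tsum_eq, ENNReal.tsum_prod']
  simp [Fin.consEquiv]

/-- The word of the `n` letters of `ω` from position `k` on. -/
def window (k : ℤ) (n : ℕ) (ω : ℤ → α) : List α := List.ofFn fun i : Fin n => ω (k + i)

@[simp] theorem length_window (k : ℤ) (n : ℕ) (ω : ℤ → α) : (window k n ω).length = n := by
  simp [window]

theorem window_add (k : ℤ) (n l : ℕ) (ω : ℤ → α) :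
    window k (n + l) ω = window k n ω ++ window (k + n) l ω := by
  simp only [window, List.ofFn_add]
  congr 2
  ext i
  simp [add_assoc]

theorem window_succ (k : ℤ) (n : ℕ) (ω : ℤ → α) :
    window k (n + 1) ω = window k n ω ++ [ω (k + n)] := by
  rw [window_add]; simp [window]

theorem window_prefix (k : ℤ) {n l : ℕ} (h : n ≤ l) (ω : ℤ → α) :
    window k n ω <+: window k l ω := by
  obtain ⟨d, rfl⟩ := Nat.exists_eq_add_of_le h
  rw [window_add]; exact List.prefix_append _ _

variable [MeasurableSpace α] [DiscreteMeasurableSpace α]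

theorem measurableSet_window_eq (k : ℤ) (n : ℕ) (x : List α) :
    MeasurableSet {ω : ℤ → α | window k n ω = x} := by
  by_cases hx : x.length = n
  · subst hx
    have : {ω : ℤ → α | window k x.length ω = x} =
        ⋂ i : Fin x.length, {ω | ω (k + i) = x.get i} := by
      ext ω
      simp only [Set.mem_ofPred_eq, Set.mem_iInter, window]
      conv_lhs => rhs; rw [← List.ofFn_get x]
      rw [List.ofFn_inj, funext_iff]
    rw [this]
    refine MeasurableSet.iInter fun i => ?_
    have h : Measurable fun ω : ℤ → α => ω (k + i) := measurable_pi_apply _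
    exact h (MeasurableSet.of_discrete (s := {x.get i}))
  · convert MeasurableSet.empty
    ext ω
    simp only [Set.mem_ofPred_eq, Set.mem_empty_iff_false, iff_false]
    rintro rfl
    simp at hx

variable (m : Measure α) [IsProbabilityMeasure m]

theorem infinitePi_window_eq (k : ℤ) (x : List α) :
    Measure.infinitePi (fun _ : ℤ => m) {ω | window k x.length ω = x} =
      wt (fun a => m {a}) x := by
  classical
  let f : Fin x.length ↪ ℤ := ⟨fun i => k + i, fun i j h => by
    have : ((i : ℕ) : ℤ) = (j : ℕ) := by simpa using h
    exact Fin.ext (by exact_mod_cast this)⟩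
  have hf : ∀ i, (f i - k).toNat = i := fun i => by
    change (k + (i : ℕ) - k : ℤ).toNat = i
    simp
  have hf' : ∀ i, f i = k + (i : ℕ) := fun _ => rfl
  let t : ℤ → Set α := fun j => {b | some b = x[(j - k).toNat]?}
  have key : {ω : ℤ → α | window k x.length ω = x} = Set.pi (Finset.univ.map f : Finset ℤ) t := by
    ext ω
    simp only [Set.mem_ofPred_eq, window]
    conv_lhs => rhs; rw [← List.ofFn_get x]
    rw [List.ofFn_inj, funext_iff]
    simp [Set.mem_pi, t, hf, ← hf']
  rw [key, Measure.infinitePi_pi _ (fun _ _ => MeasurableSet.of_discrete), Finset.prod_map]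
  conv_rhs => rw [← List.ofFn_get x, wt_ofFn]
  refine Finset.prod_congr rfl fun i _ => ?_
  congr 1
  ext b
  simp [t, hf]

theorem lintegral_window_ite (k : ℤ) (x : List α) (c : ℝ≥0∞) :
    ∫⁻ ω, Set.indicator {ω | window k x.length ω = x} (fun _ => c) ω
      ∂(Measure.infinitePi fun _ : ℤ => m) = c * wt (fun a => m {a}) x := by
  rw [lintegral_indicator_const (measurableSet_window_eq _ _ _), infinitePi_window_eq]

variable [Countable α]

theorem measurable_comp_window {β : Type*} [MeasurableSpace β] (k : ℤ) (n : ℕ) (g : List α → β) :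
    Measurable fun ω : ℤ → α => g (window k n ω) := by
  intro s _
  have : (fun ω : ℤ → α => g (window k n ω)) ⁻¹' s =
      ⋃ x ∈ {x : List α | g x ∈ s}, {ω | window k n ω = x} := by
    ext ω; simp
  rw [this]
  exact MeasurableSet.biUnion (Set.to_countable _) fun x _ => measurableSet_window_eq k n x

/-- Summing over all words amounts to integrating the sum over all initial windows; here the
window of length `n` may start at any position `κ n`. -/
theorem tsum_mul_wt (κ : ℕ → ℤ) (g : List α → ℝ≥0∞) :
    ∑' x, g x * wt (fun a => m {a}) x =
      ∫⁻ ω, ∑' n, g (window (κ n) n ω) ∂(Measure.infinitePi fun _ : ℤ => m) := by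
  simp_rw [← fun x => lintegral_window_ite m (κ x.length) x (g x)]
  rw [← lintegral_tsum fun x => (Measurable.indicator measurable_const
    (measurableSet_window_eq _ _ _)).aemeasurable]
  refine lintegral_congr fun ω => ?_
  rw [tsum_list]
  refine tsum_congr fun n => ?_
  rw [tsum_eq_single (fun i : Fin n => ω (κ n + i))]
  · simp [window]
  · intro v hv
    rw [Set.indicator_of_notMem]
    simp only [List.length_ofFn, window, Set.mem_ofPred_eq, List.ofFn_inj]
    exact fun h => hv h.symm

end Weights

/-! ### Consequences of a finite mean return time -/

section ReturnTime

variable {A S : Type*} {step : S → A → S} {e : S}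

theorem eq_window_of_prefix {p : List A} {k : ℤ} {n : ℕ} {ω : ℤ → A} (h : p <+: window k n ω) :
    p = window k p.length ω ∧ p.length ≤ n := by
  have hl : p.length ≤ n := by simpa using h.length_le
  refine ⟨List.IsPrefix.eq_of_length (List.prefix_of_prefix_length_le h (window_prefix k hl ω)
    (by simp)) (by simp), hl⟩

theorem isExcursion_window_iff {n : ℕ} {ω : ℤ → A} :
    IsExcursion step e (window 0 n ω) ↔
      ∀ j, 0 < j → j ≤ n → (window 0 j ω).foldl step e ≠ e := by
  constructor
  · intro h j hj hjn
    refine h _ (window_prefix 0 hjn ω) fun h0 => ?_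
    have := congrArg List.length h0
    simp at this; omega
  · intro h p hp hne
    obtain ⟨h1, h2⟩ := eq_window_of_prefix hp
    rw [h1]
    exact h _ (List.length_pos_iff.2 hne) h2

theorem isCycle_window_iff {n : ℕ} {ω : ℤ → A} :
    IsCycle step e (window 0 n ω) ↔
      0 < n ∧ (window 0 n ω).foldl step e = e ∧
        ∀ j, 0 < j → j < n → (window 0 j ω).foldl step e ≠ e := by
  have hne : ∀ j, window 0 j ω ≠ [] ↔ 0 < j := fun j => by
    rw [← List.length_pos_iff, length_window]
  constructor
  · rintro ⟨h0, h1, h2⟩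
    refine ⟨(hne n).1 h0, h1, fun j hj hjn => h2 _ (window_prefix 0 hjn.le ω) ((hne j).2 hj) ?_⟩
    intro h
    have := congrArg List.length h
    simp at this; omega
  · rintro ⟨h0, h1, h2⟩
    refine ⟨(hne n).2 h0, h1, fun p hp hp0 hpn => ?_⟩
    obtain ⟨h3, h4⟩ := eq_window_of_prefix hp
    rw [h3]
    refine h2 _ (List.length_pos_iff.2 hp0) (lt_of_le_of_ne h4 fun h => hpn ?_)
    rw [h3, h]

theorem isCycle_window_unique {n n' : ℕ} {ω : ℤ → A} (h : IsCycle step e (window 0 n ω))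
    (h' : IsCycle step e (window 0 n' ω)) : n = n' := by
  rw [isCycle_window_iff] at h h'
  rcases lt_trichotomy n n' with hn | hn | hn
  · exact absurd h.2.1 (h'.2.2 n h.1 hn)
  · exact hn
  · exact absurd h'.2.1 (h.2.2 n' h'.1 hn)

variable (step e) in
/-- First positive time at which the automaton, started from `e` at time `0` and fed with the
letters of `ω`, is back at `e` (`⊤` if there is none). -/
def firstReturn (ω : ℤ → A) : ℕ∞ :=
  ⨅ (n : ℕ) (_ : 0 < n ∧ (window 0 n ω).foldl step e = e), (n : ℕ∞)

theorem lt_firstReturn_of_isExcursion {n : ℕ} {ω : ℤ → A}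
    (h : IsExcursion step e (window 0 n ω)) : (n : ℕ∞) < firstReturn step e ω := by
  rw [isExcursion_window_iff] at h
  have : ((n + 1 : ℕ) : ℕ∞) ≤ firstReturn step e ω := by
    refine le_iInf₂ fun j hj => ?_
    have : n < j := by
      by_contra hjn
      exact h j hj.1 (not_lt.1 hjn) hj.2
    exact_mod_cast this
  exact lt_of_lt_of_le (by exact_mod_cast n.lt_succ_self) this

theorem le_firstReturn_of_isCycle {n : ℕ} {ω : ℤ → A}
    (h : IsCycle step e (window 0 n ω)) : (n : ℕ∞) ≤ firstReturn step e ω := by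
  rw [isCycle_window_iff] at h
  refine le_iInf₂ fun j hj => ?_
  have : n ≤ j := by
    by_contra hjn
    exact h.2.2 j hj.1 (not_le.1 hjn) hj.2
  exact_mod_cast this

theorem tsum_indicator_isExcursion_le (ω : ℤ → A) :
    ∑' n, Set.indicator {x | IsExcursion step e x} (fun _ => (1 : ℝ≥0∞)) (window 0 n ω) ≤
      (firstReturn step e ω : ℝ≥0∞) := by
  classical
  have key : ∀ n : ℕ, IsExcursion step e (window 0 n ω) → (n : ℕ∞) < firstReturn step e ω :=
    fun n => lt_firstReturn_of_isExcursion
  generalize firstReturn step e ω = t at key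
  induction t using ENat.recTopCoe with
  | top => simp
  | coe t =>
    rw [tsum_eq_sum (s := Finset.range t)]
    · refine (Finset.sum_le_sum (g := fun _ => 1) fun n _ => ?_).trans (by simp)
      exact Set.indicator_apply_le' (fun _ => le_rfl) fun _ => zero_le
    · intro n hn
      rw [Set.indicator_of_notMem]
      intro h
      exact hn (Finset.mem_range.2 (by exact_mod_cast key n h))

/-- A path has at most one initial window that is a first return word. -/
theorem tsum_indicator_isCycle (g : List A → ℝ≥0∞) (ω : ℤ → A) (c : ℝ≥0∞)
    (hc : ∀ n, IsCycle step e (window 0 n ω) → g (window 0 n ω) ≤ c) :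
    ∑' n, Set.indicator {x | IsCycle step e x} g (window 0 n ω) ≤ c := by
  by_cases h : ∃ n, IsCycle step e (window 0 n ω)
  · obtain ⟨n, hn⟩ := h
    rw [tsum_eq_single n]
    · exact (Set.indicator_of_mem (s := {x | IsCycle step e x}) hn g).trans_le (hc n hn)
    · intro n' hn'
      rw [Set.indicator_of_notMem]
      exact fun h => hn' (isCycle_window_unique h hn)
  · push Not at h
    rw [ENNReal.tsum_eq_zero.2]
    · exact zero_le
    · exact fun n => Set.indicator_of_notMem (s := {x | IsCycle step e x}) (h n) g

/-- The expected number of visits of the level `k` by the sums of `ξ` before the first return to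
`e`. -/
def occupation (step : S → A → S) (e : S) [MeasurableSpace A] (m : Measure A)
    (ξ : A → ℤ) (k : ℤ) : ℝ≥0∞ :=
  open Classical in
  ∑' x : List A, if IsExcursion step e x ∧ (x.map ξ).sum = k then wt (fun a => m {a}) x else 0

theorem tsum_occupation [MeasurableSpace A] (m : Measure A) (ξ : A → ℤ) :
    ∑' k, occupation step e m ξ k =
      ∑' x : {x : List A // IsExcursion step e x}, wt (fun a => m {a}) x.1 := by
  classical
  simp only [occupation]
  rw [ENNReal.tsum_comm]
  have := tsum_subtype {x : List A | IsExcursion step e x} (wt fun a => m {a})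
  refine Eq.trans (tsum_congr fun x => ?_) this.symm
  by_cases hx : IsExcursion step e x
  · simp [hx, Set.indicator]
  · simp [hx, Set.indicator]

variable [MeasurableSpace A] [DiscreteMeasurableSpace A] [Countable A] (m : Measure A)
  [IsProbabilityMeasure m]

theorem tsum_subtype_mul_wt (κ : ℕ → ℤ) (s : Set (List A)) (g : List A → ℝ≥0∞) :
    ∑' x : s, g x * wt (fun a => m {a}) x =
      ∫⁻ ω, ∑' n, s.indicator g (window (κ n) n ω) ∂(Measure.infinitePi fun _ : ℤ => m) := by
  rw [← tsum_mul_wt, tsum_subtype s fun x => g x * wt (fun a => m {a}) x]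
  refine tsum_congr fun x => ?_
  by_cases hx : x ∈ s <;> simp [hx]

/-- The total weight of the excursions is at most the mean return time: an excursion of length `n`
is a path whose return time exceeds `n`. -/
theorem tsum_isExcursion_wt_le :
    ∑' x : {x : List A // IsExcursion step e x}, wt (fun a => m {a}) x.1 ≤
      ∫⁻ ω, (firstReturn step e ω : ℝ≥0∞) ∂(Measure.infinitePi fun _ : ℤ => m) := by
  have := tsum_subtype_mul_wt m (fun _ => 0) {x : List A | IsExcursion step e x} (fun _ => 1)
  simp only [one_mul] at this
  exact this.trans_le (lintegral_mono fun ω => tsum_indicator_isExcursion_le ω)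

theorem tsum_isCycle_length_mul_wt_le :
    ∑' x : Cycle step e, (x.1.length : ℝ≥0∞) * wt (fun a => m {a}) x.1 ≤
      ∫⁻ ω, (firstReturn step e ω : ℝ≥0∞) ∂(Measure.infinitePi fun _ : ℤ => m) := by
  have := tsum_subtype_mul_wt m (fun _ => 0) {x : List A | IsCycle step e x}
    (fun x => (x.length : ℝ≥0∞))
  refine this.trans_le (lintegral_mono fun ω => tsum_indicator_isCycle _ _ _ fun n hn => ?_)
  rw [length_window, ← ENat.toENNReal_coe]
  exact ENat.toENNReal_le.2 (le_firstReturn_of_isCycle hn)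

variable (step e) in
theorem tsum_isCycle_wt_le_one :
    ∑' x : Cycle step e, wt (fun a => m {a}) x.1 ≤ 1 := by
  have := tsum_subtype_mul_wt m (fun _ => 0) {x : List A | IsCycle step e x} (fun _ => 1)
  simp only [one_mul] at this
  refine this.trans_le ((lintegral_mono fun ω => tsum_indicator_isCycle _ _ 1 fun n hn =>
    le_rfl).trans ?_)
  simp

/-- The occupation measure of a cycle is excessive for the random walk with increments `ξ`. -/
theorem tsum_mul_occupation_le (ξ : A → ℤ)
    (hξ : ∀ x : List A, x.foldl step e = e → (x.map ξ).sum = 0) (k : ℤ) :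
    ∑' a, m {a} * occupation step e m ξ (k - ξ a) ≤ occupation step e m ξ k := by
  classical
  set q : A → ℝ≥0∞ := fun a => m {a} with hq
  let F : List A → ℝ≥0∞ := fun y =>
    if y ≠ [] ∧ (IsExcursion step e y ∨ IsCycle step e y) ∧ (y.map ξ).sum = k then wt q y else 0
  have h1 : ∑' a, m {a} * occupation step e m ξ (k - ξ a) ≤ ∑' y, F y := by
    have hinj : Function.Injective fun p : A × List A => p.2 ++ [p.1] := by
      rintro ⟨a, x⟩ ⟨b, y⟩ h
      simpa [and_comm] using List.append_inj' h rfl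
    refine le_trans ?_ (ENNReal.tsum_comp_le_tsum_of_injective hinj F)
    rw [ENNReal.tsum_prod']
    refine ENNReal.tsum_le_tsum fun a => ?_
    rw [occupation, ← ENNReal.tsum_mul_left]
    refine ENNReal.tsum_le_tsum fun x => ?_
    split_ifs with h
    · have : (x ++ [a] ≠ []) ∧ (IsExcursion step e (x ++ [a]) ∨ IsCycle step e (x ++ [a])) ∧
          ((x ++ [a]).map ξ).sum = k := by
        refine ⟨by simp, ?_, by simp [h.2]⟩
        by_cases hr : (x ++ [a]).foldl step e = e
        · exact Or.inr (h.1.concat_isCycle a hr)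
        · exact Or.inl (h.1.concat a hr)
      simp only [F]
      rw [if_pos this]
      simp [hq, mul_comm]
    · simp
  have h2 : ∑' y, F y + (if k = 0 then 1 else 0) ≤
      occupation step e m ξ k + (if k = 0 then 1 else 0) := by
    have e1 : (if k = 0 then 1 else 0 : ℝ≥0∞) =
        ∑' y : List A, if y = [] ∧ k = 0 then 1 else 0 := by
      rw [tsum_eq_single []]
      · simp
      · intro y hy; simp [hy]
    have e2 : ∑' y : List A, (if IsCycle step e y ∧ k = 0 then wt q y else 0) ≤
        (if k = 0 then 1 else 0) := by
      by_cases hk : k = 0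
      · have := tsum_subtype {x : List A | IsCycle step e x} (wt q)
        simp only [hk, and_true, if_true]
        exact (this.symm.le.trans (tsum_isCycle_wt_le_one step e m))
      · simp [hk]
    refine le_trans ?_ (add_le_add_right e2 _)
    nth_rw 1 [e1]
    rw [occupation, ← ENNReal.tsum_add, ← ENNReal.tsum_add]
    refine ENNReal.tsum_le_tsum fun y => ?_
    by_cases hy : y = []
    · subst hy
      simp [F, isExcursion_nil, eq_comm, IsCycle]
    · by_cases hc : IsCycle step e y
      · have h0 : (y.map ξ).sum = 0 := hξ y hc.2.1
        by_cases hk : k = 0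
        · simp [F, hy, hc, h0, hk]
        · simp [F, h0, Ne.symm hk, hk]
      · simp [F, hy, hc, hq]
  refine h1.trans ((ENNReal.add_le_add_iff_right ?_).1 h2)
  split_ifs <;> simp

/-- A nondegenerate integer random walk cannot be carried by an automaton with finite mean return
time. Indeed the occupation measure of a cycle would be a finite invariant measure of the
walk; the set of the levels of maximal mass would be finite, nonempty, and invariant under
translation by a possible increment. -/
theorem increment_eq_zero_of_tsum_isExcursion_ne_top
    (hfin : ∑' x : {x : List A // IsExcursion step e x}, wt (fun a => m {a}) x.1 ≠ ∞)
    (ξ : A → ℤ) (hξ : ∀ x : List A, x.foldl step e = e → (x.map ξ).sum = 0)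
    (a : A) (ha : m {a} ≠ 0) : ξ a = 0 := by
  classical
  by_contra hne
  set π := occupation step e m ξ with hπ
  have hsum : ∑' k, π k ≠ ∞ := by rwa [hπ, tsum_occupation]
  have hm : ∑' a, m {a} = 1 := by
    rw [← measure_univ (μ := m), ← Set.biUnion_of_singleton Set.univ,
      measure_biUnion Set.countable_univ (fun a _ b _ h => by simpa using h)
        (fun _ _ => MeasurableSet.of_discrete), tsum_univ (fun a => m {a})]
  -- the total masses agree, so the excessive measure `π` is invariant
  have hinv : ∀ k, ∑' b, m {b} * π (k - ξ b) = π k := by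
    have hle : ∀ k, ∑' b, m {b} * π (k - ξ b) ≤ π k := tsum_mul_occupation_le m ξ hξ
    have htot : ∑' k, ∑' b, m {b} * π (k - ξ b) = ∑' k, π k := by
      rw [ENNReal.tsum_comm]
      have : ∀ b, ∑' k, m {b} * π (k - ξ b) = m {b} * ∑' k, π k := fun b => by
        rw [ENNReal.tsum_mul_left]
        congr 1
        exact (Equiv.subRight (ξ b)).tsum_eq π
      simp_rw [this]
      rw [ENNReal.tsum_mul_right, hm, one_mul]
    intro k
    by_contra hk
    have := ENNReal.tsum_lt_tsum (by rwa [htot]) hle (lt_of_le_of_ne (hle k) hk)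
    exact absurd htot this.ne
  have h0 : 1 ≤ π 0 := by
    have := ENNReal.le_tsum (f := fun x : List A => if IsExcursion step e x ∧ (x.map ξ).sum = 0
      then wt (fun a => m {a}) x else 0) []
    simpa [isExcursion_nil, hπ, occupation] using this
  have hF : {k | 1 ≤ π k}.Finite := ENNReal.finite_const_le_of_tsum_ne_top hsum one_ne_zero
  obtain ⟨k₀, hk₀, hmax⟩ := hF.exists_maximalFor π _ ⟨0, h0⟩
  have hmax' : ∀ k, π k ≤ π k₀ := by
    intro k
    by_cases hk : 1 ≤ π k
    · rcases le_total (π k) (π k₀) with h | h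
      · exact h
      · exact hmax hk h
    · exact (not_le.1 hk).le.trans hk₀
  have htop : ∀ k, π k ≠ ∞ := fun k => ENNReal.ne_top_of_tsum_ne_top hsum k
  have hstep : ∀ k, π k = π k₀ → π (k - ξ a) = π k₀ := by
    intro k hk
    by_contra hlt
    have hlt' : π (k - ξ a) < π k₀ := lt_of_le_of_ne (hmax' _) hlt
    have h1 : ∑' b, m {b} * π (k - ξ b) < ∑' b, m {b} * π k₀ := by
      refine ENNReal.tsum_lt_tsum (i := a) ?_ (fun b => by gcongr; exact hmax' _) ?_
      · rw [hinv]; exact htop k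
      · exact (ENNReal.mul_lt_mul_iff_right ha (measure_ne_top m _)).2 hlt'
    rw [hinv, ENNReal.tsum_mul_right, hm, one_mul, hk] at h1
    exact lt_irrefl _ h1
  have horbit : ∀ n : ℕ, π (k₀ - n * ξ a) = π k₀ := by
    intro n
    induction n with
    | zero => simp
    | succ n ih =>
      have := hstep _ ih
      rw [← this]
      congr 1
      push_cast
      ring
  refine Set.infinite_of_injective_forall_mem (f := fun n : ℕ => k₀ - n * ξ a) ?_ ?_ hF
  · intro i j hij
    simpa [hne] using hij
  · intro n
    change 1 ≤ π _
    rw [horbit]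
    exact hk₀

end ReturnTime

/-! ### Geometric contraction along independent cycles -/

theorem tsum_pow_div_ne_top {ρ : ℝ≥0∞} (hρ : ρ < 1) {K : ℕ} (hK : 0 < K) :
    ∑' i : ℕ, ρ ^ (i / K) ≠ ∞ := by
  have : NeZero K := ⟨hK.ne'⟩
  rw [← (Nat.divModEquiv K).symm.tsum_eq, ENNReal.tsum_prod']
  have h : ∀ (j : ℕ) (l : Fin K), ((Nat.divModEquiv K).symm (j, l)) / K = j := by
    intro j l
    rw [Nat.divModEquiv_symm_apply, mul_comm, Nat.mul_add_div hK, Nat.div_eq_of_lt l.2, add_zero]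
  simp_rw [h]
  simp only [tsum_fintype, Finset.sum_const, Finset.card_univ, Fintype.card_fin, nsmul_eq_mul]
  rw [ENNReal.tsum_mul_left, ENNReal.tsum_geometric]
  refine ENNReal.mul_ne_top (by simp) (ENNReal.inv_ne_top.2 ?_)
  exact (tsub_pos_of_lt hρ).ne'

/-- An exponentially large initial factor costs only a linear number of contraction steps. -/
theorem exists_tsum_min_one_le {ρ B : ℝ≥0∞} (hρ : ρ < 1) (hB : B ≠ ∞) {K : ℕ} (hK : 0 < K) :
    ∃ c : ℝ≥0∞, c ≠ ∞ ∧ ∀ n : ℕ,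
      ∑' i : ℕ, min 1 (B ^ (n + 1) * ρ ^ (i / K)) ≤ c * (n + 1) := by
  obtain ⟨t, ht⟩ : ∃ t : ℕ, B * ρ ^ t ≤ 1 := by
    have h := ENNReal.Tendsto.const_mul (a := B) (ENNReal.tendsto_pow_atTop_nhds_zero_of_lt_one hρ)
      (Or.inr hB)
    rw [mul_zero] at h
    exact ((h.eventually_lt_const one_pos).exists).imp fun _ => le_of_lt
  have hH := tsum_pow_div_ne_top hρ hK
  refine ⟨K * t + ∑' i : ℕ, ρ ^ (i / K), ENNReal.add_ne_top.2 ⟨by finiteness, hH⟩, fun n => ?_⟩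
  rw [← Summable.sum_add_tsum_nat_add' (k := K * (t * (n + 1))) ENNReal.summable, add_mul]
  refine add_le_add ?_ ?_
  · refine (Finset.sum_le_sum (g := fun _ => 1) fun i _ => min_le_left _ _).trans ?_
    simp [mul_assoc]
  · have h1 : ∀ i : ℕ, min 1 (B ^ (n + 1) * ρ ^ ((i + K * (t * (n + 1))) / K)) ≤ ρ ^ (i / K) := by
      intro i
      refine (min_le_right _ _).trans ?_
      rw [Nat.add_mul_div_left _ _ hK, pow_add ρ, mul_comm (ρ ^ (i / K)), ← mul_assoc, pow_mul,
        ← mul_pow]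
      exact mul_le_of_le_one_left zero_le (pow_le_one₀ zero_le ht)
    refine (ENNReal.tsum_le_tsum h1).trans ?_
    exact le_mul_of_one_le_right zero_le (by simp)

section Contraction

variable {C S : Type*} (act : S → C → S) (q : C → ℝ≥0∞)

/-- Expected value of `F` after `n` independent steps from `s`. -/
def iterMean (F : S → ℝ≥0∞) : ℕ → S → ℝ≥0∞
  | 0, s => F s
  | n + 1, s => ∑' c, q c * iterMean F n (act s c)

theorem iterMean_eq_tsum (F : S → ℝ≥0∞) (n : ℕ) (s : S) :
    iterMean act q F n s =
      ∑' v : Fin n → C, wt q (List.ofFn v) * F ((List.ofFn v).foldl act s) := by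
  induction n generalizing s with
  | zero => simp [iterMean, tsum_fintype]
  | succ n ih =>
    rw [tsum_ofFn_succ n fun x => wt q x * F (x.foldl act s), iterMean]
    refine tsum_congr fun c => ?_
    rw [ih, ← ENNReal.tsum_mul_left]
    refine tsum_congr fun v => ?_
    simp [mul_assoc]

theorem iterMean_add_le {F : S → ℝ≥0∞} {n : ℕ} {b : ℝ≥0∞}
    (h : ∀ s, iterMean act q F n s ≤ b * F s) (k : ℕ) (s : S) :
    iterMean act q F (k + n) s ≤ b * iterMean act q F k s := by
  induction k generalizing s with
  | zero => simpa [iterMean] using h s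
  | succ k ih =>
    rw [Nat.add_right_comm, iterMean, iterMean, ← ENNReal.tsum_mul_left]
    refine ENNReal.tsum_le_tsum fun c => ?_
    rw [mul_left_comm]
    gcongr
    exact ih _

theorem tsum_wt_ofFn_le_one (hq : ∑' c, q c ≤ 1) (n : ℕ) :
    ∑' v : Fin n → C, wt q (List.ofFn v) ≤ 1 := by
  induction n with
  | zero => simp [tsum_fintype]
  | succ n ih =>
    rw [tsum_ofFn_succ n (wt q)]
    simp only [wt_cons]
    simp_rw [ENNReal.tsum_mul_left]
    rw [ENNReal.tsum_mul_right]
    exact mul_le_one' hq ih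

variable (e : S) (len : S → ℕ)

open Classical in
/-- Exponential potential of a state, which vanishes at the base state `e`. -/
def potential (s : S) : ℝ≥0∞ := if s = e then 0 else 2 ^ len s

theorem potential_le (s : S) : potential e len s ≤ 2 ^ len s := by
  unfold potential
  split_ifs <;> simp

theorem one_le_potential {s : S} (hs : s ≠ e) : 1 ≤ potential e len s := by
  rw [potential, if_neg hs]
  exact one_le_pow₀ one_le_two

variable {act q e len}

theorem foldl_base (he : ∀ c, act e c = e) (L : List C) : L.foldl act e = e := by
  induction L with
  | nil => rfl
  | cons c L ih => rw [List.foldl_cons, he, ih]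

theorem len_foldl_le (hmono : ∀ s c, q c ≠ 0 → len (act s c) ≤ len s) (s : S) (L : List C)
    (hL : wt q L ≠ 0) : len (L.foldl act s) ≤ len s := by
  induction L generalizing s with
  | nil => exact le_rfl
  | cons c L ih =>
    rw [wt_cons, mul_ne_zero_iff] at hL
    exact (ih (act s c) hL.2).trans (hmono s c hL.1)

variable (hq : ∑' c, q c ≤ 1) (he : ∀ c, act e c = e)
  (hmono : ∀ s c, q c ≠ 0 → len (act s c) ≤ len s)

include hq he hmono

theorem iterMean_potential_le (n : ℕ) (s : S) :
    iterMean act q (potential e len) n s ≤ 1 * potential e len s := by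
  rw [one_mul, iterMean_eq_tsum]
  by_cases hs : s = e
  · subst hs
    rw [ENNReal.tsum_eq_zero.2]
    · exact zero_le
    · intro v
      rw [foldl_base he, potential, if_pos rfl, mul_zero]
  · refine (ENNReal.tsum_le_tsum (g := fun v => wt q (List.ofFn v) * 2 ^ len s) fun v => ?_).trans ?_
    · by_cases hv : wt q (List.ofFn v) = 0
      · simp [hv]
      · gcongr
        refine (potential_le e len _).trans ?_
        exact pow_le_pow_right₀ one_le_two (len_foldl_le hmono s _ hv)
    · rw [ENNReal.tsum_mul_right, potential, if_neg hs]
      exact mul_le_of_le_one_left zero_le (tsum_wt_ofFn_le_one q hq n)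

variable {K : ℕ} {δ : ℝ≥0∞}
  (hdrop : ∀ s, s ≠ e → ∃ v : Fin K → C, δ ≤ wt q (List.ofFn v) ∧
    len ((List.ofFn v).foldl act s) < len s)

include hdrop

/-- If from every state a block of `K` steps makes the length drop with probability at least `δ`,
then the mean potential is contracted by `1 - δ / 2` over a block. -/
theorem iterMean_potential_block_le (s : S) :
    iterMean act q (potential e len) K s ≤ (1 - δ / 2) * potential e len s := by
  classical
  by_cases hs : s = e
  · refine (iterMean_potential_le hq he hmono K s).trans ?_
    simp [potential, hs]
  obtain ⟨v₀, hv₀, hlt⟩ := hdrop s hs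
  have hδ : δ ≤ 1 := hv₀.trans ((ENNReal.le_tsum v₀).trans (tsum_wt_ofFn_le_one q hq K))
  set M : ℝ≥0∞ := 2 ^ len s with hM
  have hMtop : M ≠ ∞ := by finiteness
  have hsM : potential e len s = M := by rw [potential, if_neg hs]
  have hhalf : (2 : ℝ≥0∞) ^ len ((List.ofFn v₀).foldl act s) ≤ M / 2 := by
    rw [ENNReal.le_div_iff_mul_le (by simp) (by simp), ← pow_succ]
    exact pow_le_pow_right₀ one_le_two hlt
  have key : iterMean act q (potential e len) K s + δ / 2 * M ≤ M := by
    rw [iterMean_eq_tsum]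
    calc _ ≤ ∑' v : Fin K → C, wt q (List.ofFn v) * potential e len ((List.ofFn v).foldl act s) +
          ∑' v : Fin K → C, (if v = v₀ then wt q (List.ofFn v) * (M / 2) else 0) := by
          gcongr
          rw [tsum_ite_eq, ENNReal.mul_div_right_comm.symm, mul_div_assoc]
          gcongr
      _ ≤ ∑' v : Fin K → C, wt q (List.ofFn v) * M := by
          rw [← ENNReal.tsum_add]
          refine ENNReal.tsum_le_tsum fun v => ?_
          by_cases hv : v = v₀
          · subst hv
            rw [if_pos rfl, ← mul_add]
            gcongr
            calc _ ≤ M / 2 + M / 2 := by gcongr; exact (potential_le e len _).trans hhalf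
              _ = M := ENNReal.add_halves M
          · rw [if_neg hv, add_zero]
            by_cases hz : wt q (List.ofFn v) = 0
            · simp [hz]
            · gcongr
              refine (potential_le e len _).trans ?_
              exact pow_le_pow_right₀ one_le_two (len_foldl_le hmono s _ hz)
      _ ≤ M := by
          rw [ENNReal.tsum_mul_right]
          exact mul_le_of_le_one_left zero_le (tsum_wt_ofFn_le_one q hq K)
  rw [hsM, ENNReal.sub_mul (fun _ _ => hMtop), one_mul]
  exact ENNReal.le_sub_of_add_le_right (ENNReal.mul_ne_top
    (ENNReal.div_ne_top (ne_top_of_le_ne_top ENNReal.one_ne_top hδ) two_ne_zero) hMtop) key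

theorem iterMean_potential_pow_le (n : ℕ) (s : S) :
    iterMean act q (potential e len) n s ≤ (1 - δ / 2) ^ (n / K) * potential e len s := by
  rcases Nat.eq_zero_or_pos K with hK | hK
  · subst hK
    simpa using iterMean_potential_le hq he hmono n s
  induction n using Nat.strong_induction_on generalizing s with
  | _ n ih =>
    by_cases hn : n < K
    · rw [Nat.div_eq_of_lt hn, pow_zero]
      exact iterMean_potential_le hq he hmono n s
    · obtain ⟨d, rfl⟩ := Nat.exists_eq_add_of_le (not_lt.1 hn)
      refine (iterMean_add_le act q (fun s => ih d (by omega) s) K s).trans ?_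
      rw [Nat.add_div_left _ hK, pow_succ, mul_assoc]
      gcongr
      exact iterMean_potential_block_le hq he hmono hdrop s

/-- The expected number of steps after which some member of a finite family of states has not yet
reached the base state is at most linear in the logarithm of the potential of the family. -/
theorem exists_tsum_list_le (hK : 0 < K) (hδ : δ ≠ 0) (B : ℕ) :
    ∃ c : ℝ≥0∞, c ≠ ∞ ∧ ∀ (n R : ℕ) (F : Finset S), (∀ s ∈ F, len s ≤ R) →
      F.card * 2 ^ R ≤ B ^ (n + 1) →
      ∑' L : List C, Set.indicator {L | ∃ s ∈ F, L.foldl act s ≠ e} (wt q) L ≤ c * (n + 1) := by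
  have hρ : 1 - δ / 2 < 1 := by
    refine ENNReal.sub_lt_self (by simp) one_ne_zero ?_
    simpa using hδ
  obtain ⟨c, hc, h⟩ := exists_tsum_min_one_le hρ (ENNReal.natCast_ne_top B) hK
  refine ⟨c, hc, fun n R F hF hcard => ?_⟩
  rw [tsum_list]
  refine (ENNReal.tsum_le_tsum fun i => ?_).trans (h n)
  refine le_min ?_ ?_
  · refine (ENNReal.tsum_le_tsum fun v => ?_).trans (tsum_wt_ofFn_le_one q hq i)
    exact Set.indicator_le_self _ _ _
  · calc ∑' v : Fin i → C, Set.indicator {L | ∃ s ∈ F, L.foldl act s ≠ e} (wt q) (List.ofFn v)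
        ≤ ∑' v : Fin i → C, ∑ s ∈ F,
            wt q (List.ofFn v) * potential e len ((List.ofFn v).foldl act s) := by
          refine ENNReal.tsum_le_tsum fun v => Set.indicator_apply_le' ?_ fun _ => zero_le
          rintro ⟨s, hs, hne⟩
          refine le_trans ?_ (Finset.single_le_sum (fun _ _ => zero_le) hs)
          exact le_mul_of_one_le_right zero_le (one_le_potential e len hne)
      _ = ∑ s ∈ F, iterMean act q (potential e len) i s := by
          rw [Summable.tsum_finsetSum fun _ _ => ENNReal.summable]
          simp_rw [iterMean_eq_tsum]
      _ ≤ ∑ s ∈ F, (1 - δ / 2) ^ (i / K) * 2 ^ R := by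
          refine Finset.sum_le_sum fun s hs => ?_
          refine (iterMean_potential_pow_le hq he hmono hdrop i s).trans ?_
          gcongr
          exact (potential_le e len s).trans (pow_le_pow_right₀ one_le_two (hF s hs))
      _ = (F.card * 2 ^ R : ℕ) * (1 - δ / 2) ^ (i / K) := by
          rw [Finset.sum_const, nsmul_eq_mul]; push_cast; ring
      _ ≤ (B : ℝ≥0∞) ^ (n + 1) * (1 - δ / 2) ^ (i / K) := by
          gcongr
          exact_mod_cast hcard

end Contraction

/-! ### Backward coalescence -/

section Coalescence

variable {A S : Type*} {step : S → A → S} {e : S} {len : S → ℕ}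

theorem wt_joinCycles (q : A → ℝ≥0∞) (L : List (Cycle step e)) :
    wt q (joinCycles L) = wt (fun x : Cycle step e => wt q x.1) L := by
  induction L with
  | nil => rfl
  | cons x L ih => rw [joinCycles_cons, wt_append, wt_cons, ih]

theorem foldl_foldl_cycles (L : List (Cycle step e)) (s : S) :
    L.foldl (fun s (x : Cycle step e) => x.1.foldl step s) s = (joinCycles L).foldl step s := by
  induction L generalizing s with
  | nil => rfl
  | cons x L ih => rw [joinCycles_cons, List.foldl_append, List.foldl_cons, ih]

theorem flatten_ofFn_singleton {n : ℕ} (v : Fin n → A) :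
    (List.ofFn fun i => [v i]).flatten = List.ofFn v := by
  induction n with
  | zero => simp
  | succ n ih => simp [List.ofFn_succ, ih fun i => v i.succ]

theorem len_foldl_le_add {c : ℕ} (hlen : ∀ s a, len (step s a) ≤ len s + c) (x : List A) (s : S) :
    len (x.foldl step s) ≤ len s + c * x.length := by
  induction x generalizing s with
  | nil => simp
  | cons a x ih =>
    have h1 := ih (step s a)
    have h2 := hlen s a
    rw [List.foldl_cons, List.length_cons, mul_add]
    omega

variable (step e len) in
/-- The cycle `x` followed by the cycles `L` is slow (for initial states of length at most `R`) if
some state of length at most `R`, introduced somewhere during `x`, has not been driven to `e` at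
the end of `L`. -/
def IsSlow (R : ℕ) (x : Cycle step e) (L : List (Cycle step e)) : Prop :=
  ∃ s', s' <:+ x.1 ∧ ∃ s, len s ≤ R ∧ (s' ++ joinCycles L).foldl step s ≠ e

variable (step e len) in
/-- The late words: excursions, and words made of a cycle `x`, a sequence of cycles `L` that is slow
for `x`, and an excursion. Read backwards from time `0`, they are the pieces of input over which
the systems started during `x`, or during the last excursion, may fail to coalesce. -/
def lateWords (R : ℕ) : Set (List A) :=
  {t | IsExcursion step e t ∨ ∃ (x : Cycle step e) (L : List (Cycle step e)) (y : List A),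
    IsSlow step e len R x L ∧ IsExcursion step e y ∧ t = x.1 ++ joinCycles L ++ y}

/-- If no long suffix of `z` is a late word, then all long suffixes of `z` lead from all short
states to the same state. -/
theorem foldl_eq_of_suffix {R N : ℕ} {z : List A}
    (h : ∀ t, t <:+ z → N ≤ t.length → t ∉ lateWords step e len R) {s : S} (hs : len s ≤ R)
    {t : List A} (ht : t <:+ z) (hN : N ≤ t.length) :
    t.foldl step s = z.foldl step e := by
  obtain ⟨L, y, hy, rfl⟩ := exists_eq_joinCycles_append (step := step) (e := e) z
  have hyN : y.length < N := by
    by_contra hc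
    exact h y (List.suffix_append _ _) (not_lt.1 hc) (Or.inl hy)
  obtain ⟨t', rfl⟩ := List.suffix_of_suffix_length_le (List.suffix_append _ y) ht
    (hyN.le.trans hN)
  have ht' : t' <:+ joinCycles L := by
    obtain ⟨u, hu⟩ := ht
    exact ⟨u, by simpa [← List.append_assoc] using hu⟩
  have hne : t' ≠ [] := by
    rintro rfl
    simp at hN
    omega
  obtain ⟨x, L', s', h1, rfl, h3⟩ := exists_of_suffix_joinCycles L t' hne ht'
  have hret : (s' ++ joinCycles L').foldl step s = e := by
    by_contra hc
    refine h (x.1 ++ joinCycles L' ++ y) ?_ ?_ (Or.inr ⟨x, L', y, ⟨s', h1, s, hs, hc⟩, hy, rfl⟩)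
    · obtain ⟨u, hu⟩ := h3
      exact ⟨u, by rw [← hu]; simp⟩
    · have := h1.length_le
      simp only [List.length_append] at hN ⊢
      omega
  rw [List.foldl_append, hret, List.foldl_append, foldl_joinCycles]

variable [MeasurableSpace A] [DiscreteMeasurableSpace A] [Countable A] (m : Measure A)
  [IsProbabilityMeasure m]

/-- The weight of the sequences of cycles after which some system started during `x` is not yet
at `e` is at most linear in the length of `x`: there are at most exponentially many such systems,
with an at most exponentially large potential. -/
theorem tsum_isSlow_le (hlen : ∀ s a, len (step s a) ≤ len s + 2)
    (hball : ∀ R, {s | len s ≤ R}.Finite)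
    (hmono : ∀ s (x : List A), wt (fun a => m {a}) x ≠ 0 → x.foldl step e = e →
      len (x.foldl step s) ≤ len s)
    {K : ℕ} (hK : 0 < K) {δ : ℝ≥0∞} (hδ : δ ≠ 0)
    (hdrop : ∀ s, s ≠ e → ∃ v : Fin K → A, (∀ i, step e (v i) = e) ∧
      δ ≤ wt (fun a => m {a}) (List.ofFn v) ∧ len ((List.ofFn v).foldl step s) < len s) (R : ℕ) :
    ∃ c : ℝ≥0∞, c ≠ ∞ ∧ ∀ x : Cycle step e,
      ∑' L : List (Cycle step e), Set.indicator {L | IsSlow step e len R x L}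
        (fun L => wt (fun a => m {a}) (joinCycles L)) L ≤ c * (x.1.length + 1) := by
  classical
  set q : Cycle step e → ℝ≥0∞ := fun x => wt (fun a => m {a}) x.1 with hq
  set b := (hball R).toFinset.card with hb
  obtain ⟨c, hc, h⟩ := exists_tsum_list_le
    (act := fun s (x : Cycle step e) => x.1.foldl step s) (q := q) (e := e) (len := len)
    (tsum_isCycle_wt_le_one step e m) (fun x => x.2.2.1)
    (fun s x hx => hmono s x.1 hx x.2.2.1) (K := K) (δ := δ) (fun s hs => by
      obtain ⟨v, h1, h2, h3⟩ := hdrop s hs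
      have hj : joinCycles (List.ofFn fun i => (⟨[v i], isCycle_singleton (h1 i)⟩ : Cycle step e)) =
          List.ofFn v := by
        rw [joinCycles, List.map_ofFn]
        exact flatten_ofFn_singleton v
      refine ⟨fun i => ⟨[v i], isCycle_singleton (h1 i)⟩, ?_, ?_⟩
      · rw [hq, ← wt_joinCycles, hj]; exact h2
      · rw [foldl_foldl_cycles, hj]; exact h3) hK hδ (8 * (b + 1) * 2 ^ R)
  refine ⟨c, hc, fun x => ?_⟩
  set n := x.1.length with hn
  -- all the states obtained at the end of the cycle `x`
  let F : Finset S := (Finset.range (n + 1) ×ˢ (hball R).toFinset).image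
    fun p => (x.1.drop p.1).foldl step p.2
  have hF : ∀ s ∈ F, len s ≤ R + 2 * n := by
    intro s hs
    obtain ⟨p, hp, rfl⟩ := Finset.mem_image.1 hs
    have h1 : len p.2 ≤ R := by simpa using (Finset.mem_product.1 hp).2
    have h2 := len_foldl_le_add hlen (x.1.drop p.1) p.2
    have h3 : (x.1.drop p.1).length ≤ n := by simp [hn]
    omega
  have hcard : F.card * 2 ^ (R + 2 * n) ≤ (8 * (b + 1) * 2 ^ R) ^ (n + 1) := by
    have h1 : F.card ≤ (n + 1) * b := by
      refine Finset.card_image_le.trans ?_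
      rw [Finset.card_product, Finset.card_range]
    have h2 : n + 1 ≤ 2 ^ (n + 1) := Nat.lt_two_pow_self.le
    have h3 : b ≤ (b + 1) ^ (n + 1) :=
      (Nat.le_succ b).trans (Nat.le_self_pow n.succ_ne_zero _)
    have h4 : 2 ^ (R + 2 * n) ≤ (2 ^ R) ^ (n + 1) * 4 ^ (n + 1) := by
      rw [pow_add, pow_mul 2 2 n]
      refine Nat.mul_le_mul (Nat.le_self_pow n.succ_ne_zero _) ?_
      exact Nat.pow_le_pow_right (by norm_num) n.le_succ
    calc _ ≤ (n + 1) * b * 2 ^ (R + 2 * n) := Nat.mul_le_mul_right _ h1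
      _ ≤ 2 ^ (n + 1) * (b + 1) ^ (n + 1) * ((2 ^ R) ^ (n + 1) * 4 ^ (n + 1)) := by gcongr
      _ = (8 * (b + 1) * 2 ^ R) ^ (n + 1) := by
        rw [show 8 * (b + 1) * 2 ^ R = 2 * (b + 1) * (2 ^ R * 4) by ring]
        simp only [mul_pow]
  refine le_trans (ENNReal.tsum_le_tsum fun L => ?_) (h n (R + 2 * n) F hF hcard)
  rw [show wt q = fun L => wt (fun a => m {a}) (joinCycles L) from
    funext fun L => (wt_joinCycles _ L).symm]
  refine Set.indicator_apply_le' ?_ fun _ => zero_le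
  rintro ⟨s', hs', s, hs, hne⟩
  rw [Set.indicator_of_mem]
  refine ⟨s'.foldl step s, Finset.mem_image.2 ⟨(n - s'.length, s), ?_, ?_⟩, ?_⟩
  · simp only [Finset.mem_product, Finset.mem_range, Set.Finite.mem_toFinset, Set.mem_ofPred_eq]
    exact ⟨by omega, hs⟩
  · rw [← List.suffix_iff_eq_drop.1 hs']
  · rw [foldl_foldl_cycles, ← List.foldl_append]
    exact hne

/-- The late words have a finite total weight: summing first over `L`, the weight of the words
`x ++ L ++ y` is at most a multiple of the product of the means of `|x| + 1` and of the return
time. -/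
theorem tsum_lateWords_ne_top (hlen : ∀ s a, len (step s a) ≤ len s + 2)
    (hball : ∀ R, {s | len s ≤ R}.Finite)
    (hmono : ∀ s (x : List A), wt (fun a => m {a}) x ≠ 0 → x.foldl step e = e →
      len (x.foldl step s) ≤ len s)
    {K : ℕ} (hK : 0 < K) {δ : ℝ≥0∞} (hδ : δ ≠ 0)
    (hdrop : ∀ s, s ≠ e → ∃ v : Fin K → A, (∀ i, step e (v i) = e) ∧
      δ ≤ wt (fun a => m {a}) (List.ofFn v) ∧ len ((List.ofFn v).foldl step s) < len s)
    (hfin : ∫⁻ ω, (firstReturn step e ω : ℝ≥0∞) ∂(Measure.infinitePi fun _ : ℤ => m) ≠ ∞)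
    (R : ℕ) :
    ∑' t : lateWords step e len R, wt (fun a => m {a}) t.1 ≠ ∞ := by
  classical
  obtain ⟨c, hc, hslow⟩ := tsum_isSlow_le m hlen hball hmono hK hδ hdrop R
  set q : A → ℝ≥0∞ := fun a => m {a} with hq
  have hexc := ne_top_of_le_ne_top hfin (tsum_isExcursion_wt_le (step := step) (e := e) m)
  have hcyc := ne_top_of_le_ne_top hfin (tsum_isCycle_length_mul_wt_le (step := step) (e := e) m)
  have hone := tsum_isCycle_wt_le_one step e m
  let E := {x : List A // IsExcursion step e x}
  let D := {p : Cycle step e × List (Cycle step e) × E // IsSlow step e len R p.1 p.2.1}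
  let f : E ⊕ D → lateWords step e len R := Sum.elim (fun y => ⟨y.1, Or.inl y.2⟩)
    fun p => ⟨p.1.1.1 ++ joinCycles p.1.2.1 ++ p.1.2.2.1,
      Or.inr ⟨p.1.1, p.1.2.1, p.1.2.2.1, p.2, p.1.2.2.2, rfl⟩⟩
  have hf : Function.Surjective f := by
    rintro ⟨t, ht | ⟨x, L, y, h1, h2, rfl⟩⟩
    · exact ⟨Sum.inl ⟨t, ht⟩, rfl⟩
    · exact ⟨Sum.inr ⟨(x, L, ⟨y, h2⟩), h1⟩, rfl⟩
  refine ne_top_of_le_ne_top ?_ (ENNReal.tsum_le_tsum_comp_of_surjective hf fun t => wt q t.1)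
  rw [Summable.tsum_sum (f := fun p => wt q (f p).1) ENNReal.summable ENNReal.summable]
  refine ENNReal.add_ne_top.2 ⟨hexc, ?_⟩
  have hD : ∑' p : D, wt q (f (Sum.inr p)).1 ≤
      (c * (∑' x : Cycle step e, (x.1.length : ℝ≥0∞) * wt q x.1 + 1)) * ∑' y : E, wt q y.1 := by
    let g : Cycle step e × List (Cycle step e) × E → ℝ≥0∞ := fun p =>
      wt q p.1.1 * (Set.indicator {L | IsSlow step e len R p.1 L}
        (fun L => wt q (joinCycles L)) p.2.1 * wt q p.2.2.1)
    calc ∑' p : D, wt q (f (Sum.inr p)).1 = ∑' p : D, g p.1 := by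
          refine tsum_congr fun p => ?_
          have : p.1.2.1 ∈ {L | IsSlow step e len R p.1.1 L} := p.2
          simp only [f, g, Sum.elim_inr, wt_append, Set.indicator_of_mem this, mul_assoc]
      _ ≤ ∑' p, g p := ENNReal.tsum_comp_le_tsum_of_injective Subtype.val_injective g
      _ = (∑' x : Cycle step e, wt q x.1 * ∑' L, Set.indicator {L | IsSlow step e len R x L}
            (fun L => wt q (joinCycles L)) L) * ∑' y : E, wt q y.1 := by
          rw [ENNReal.tsum_prod']
          simp_rw [ENNReal.tsum_prod', g, ENNReal.tsum_mul_left, ENNReal.tsum_mul_right]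
          simp_rw [← mul_assoc, ENNReal.tsum_mul_right]
      _ ≤ (∑' x : Cycle step e, wt q x.1 * (c * (x.1.length + 1))) * ∑' y : E, wt q y.1 := by
          gcongr with x
          exact hslow x
      _ = (c * (∑' x : Cycle step e, (x.1.length : ℝ≥0∞) * wt q x.1 +
            ∑' x : Cycle step e, wt q x.1)) * ∑' y : E, wt q y.1 := by
          congr 1
          rw [← ENNReal.tsum_add, ← ENNReal.tsum_mul_left]
          refine tsum_congr fun x => ?_
          ring
      _ ≤ _ := by gcongr
  exact ne_top_of_le_ne_top (by finiteness) hD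

/-- Backward coalescence: almost surely, all the systems started far enough in the past from a
state of length at most `R` are in the same state at time `0`. -/
theorem ae_exists_foldl_window_eq (hlen : ∀ s a, len (step s a) ≤ len s + 2)
    (hball : ∀ R, {s | len s ≤ R}.Finite) (he : len e = 0)
    (hmono : ∀ s (x : List A), wt (fun a => m {a}) x ≠ 0 → x.foldl step e = e →
      len (x.foldl step s) ≤ len s)
    {K : ℕ} (hK : 0 < K) {δ : ℝ≥0∞} (hδ : δ ≠ 0)
    (hdrop : ∀ s, s ≠ e → ∃ v : Fin K → A, (∀ i, step e (v i) = e) ∧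
      δ ≤ wt (fun a => m {a}) (List.ofFn v) ∧ len ((List.ofFn v).foldl step s) < len s)
    (hfin : ∫⁻ ω, (firstReturn step e ω : ℝ≥0∞) ∂(Measure.infinitePi fun _ : ℤ => m) ≠ ∞)
    (R : ℕ) :
    ∀ᵐ ω ∂(Measure.infinitePi fun _ : ℤ => m), ∃ (N : ℕ) (u : S), ∀ n, N ≤ n → ∀ s, len s ≤ R →
      (window (-n) n ω).foldl step s = u := by
  have hsum := tsum_lateWords_ne_top m hlen hball hmono hK hδ hdrop hfin R
  have hBC : ∀ᵐ ω ∂(Measure.infinitePi fun _ : ℤ => m),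
      ∀ᶠ n : ℕ in Filter.atTop, window (-n) n ω ∉ lateWords step e len R := by
    have h1 := tsum_subtype_mul_wt m (fun n => -(n : ℤ)) (lateWords step e len R) fun _ => 1
    simp only [one_mul] at h1
    rw [h1] at hsum
    have h2 := ae_lt_top (by
      exact Measurable.tsum fun n => measurable_comp_window _ n _) hsum
    filter_upwards [h2] with ω hω
    have h3 := ENNReal.finite_const_le_of_tsum_ne_top hω.ne one_ne_zero
    have h4 := h3.eventually_cofinite_notMem
    rw [Nat.cofinite_eq_atTop] at h4
    filter_upwards [h4] with n hn hmem
    exact hn (by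
      rw [Set.indicator_of_mem hmem])
  filter_upwards [hBC] with ω hω
  obtain ⟨N, hN⟩ := Filter.eventually_atTop.1 hω
  have hsuf : ∀ {n l : ℕ}, n ≤ l → window (-(n : ℤ)) n ω <:+ window (-(l : ℤ)) l ω := by
    intro n l hnl
    obtain ⟨d, rfl⟩ := Nat.exists_eq_add_of_le' hnl
    rw [window_add]
    rw [show -((d + n : ℕ) : ℤ) + d = -n by push_cast; ring]
    exact List.suffix_append _ _
  have hz : ∀ n, N ≤ n → ∀ s, len s ≤ R → ∀ l, n ≤ l →
      (window (-n) n ω).foldl step s = (window (-l) l ω).foldl step e := by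
    intro n hn s hs l hl
    refine foldl_eq_of_suffix (len := len) (R := R) (N := N) (fun t ht htN => ?_) hs (hsuf hl)
      (by simpa using hn)
    have htl : t.length ≤ l := by simpa using ht.length_le
    have : t = window (-(t.length : ℤ)) t.length ω :=
      List.IsSuffix.eq_of_length (List.suffix_of_suffix_length_le ht (hsuf htl) (by simp))
        (by simp)
    rw [this]
    exact hN _ htN
  refine ⟨N, (window (-N) N ω).foldl step e, fun n hn s hs => ?_⟩
  rw [hz n hn s hs n le_rfl, ← hz N le_rfl e (by omega) n hn]

end Coalescence

variable {V : Type*} {G : SimpleGraph V}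

/-! ### Queues under a matching policy -/

instance [Finite V] : Finite (Prefs G) :=
  inferInstanceAs (Finite (∀ v : V, Equiv.Perm (G.neighborSet v)))

instance [Finite V] : Countable (EvenQueue G) :=
  inferInstanceAs (Countable {_w : {_w : List V // _} // _})

theorem EvenQueue.ext {s t : EvenQueue G} (h : s.1.1 = t.1.1) : s = t :=
  Subtype.ext (Subtype.ext h)

theorem EvenQueue.eq_empty_iff {s : EvenQueue G} : s = EvenQueue.empty ↔ s.length = 0 := by
  constructor
  · rintro rfl; rfl
  · intro h
    exact EvenQueue.ext (List.length_eq_zero_iff.1 h)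

theorem EvenQueue.finite_length_le [Finite V] (R : ℕ) :
    {s : EvenQueue G | s.length ≤ R}.Finite := by
  refine Set.Finite.preimage (f := fun s : EvenQueue G => s.1.1)
    (fun s _ t _ h => EvenQueue.ext h) (List.finite_length_le V R)

namespace MatchingPolicy

variable (φ : MatchingPolicy G)

theorem exists_cons_act_perm (w : QueueDetail G) (v : V) (σ : Prefs G)
    (h : ∃ j ∈ w.1, G.Adj v j) :
    ∃ j, G.Adj v j ∧ (j :: (φ.act w (v, σ)).1).Perm w.1 := by
  obtain ⟨k, hk, hadj, he⟩ := φ.act_match w v σ h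
  exact ⟨_, hadj, by rw [he]; exact List.getElem_cons_eraseIdx_perm hk⟩

theorem length_act_le (w : QueueDetail G) (p : V × Prefs G) :
    (φ.act w p).length ≤ w.length + 1 := by
  obtain ⟨v, σ⟩ := p
  by_cases h : ∃ j ∈ w.1, G.Adj v j
  · obtain ⟨j, -, hp⟩ := φ.exists_cons_act_perm w v σ h
    have := hp.length_eq
    simp only [List.length_cons] at this
    unfold QueueDetail.length
    omega
  · unfold QueueDetail.length
    rw [φ.act_store w v σ fun j hj ha => h ⟨j, hj, ha⟩]
    simp

theorem length_evenStep_le (s : EvenQueue G) (a : (V × Prefs G) × (V × Prefs G)) :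
    (φ.evenStep s a).length ≤ s.length + 2 := by
  have h1 := φ.length_act_le s.1 a.1
  have h2 := φ.length_act_le (φ.act s.1 a.1) a.2
  unfold EvenQueue.length evenStep
  dsimp only
  omega

/-- Every queue detail is reached from the empty system by letting its own letters arrive. -/
theorem finalQueue_map_prod (w : QueueDetail G) (σ : Prefs G) :
    φ.finalQueue (w.1.map fun v => (v, σ)) = w := by
  obtain ⟨l, hl⟩ := w
  induction l using List.reverseRecOn with
  | nil => rfl
  | append_singleton l v ih =>
    have hl' : ∀ i j : V, G.Adj i j → ¬ (i ∈ l ∧ j ∈ l) := fun i j h hij =>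
      hl i j h ⟨List.mem_append_left _ hij.1, List.mem_append_left _ hij.2⟩
    have h1 := ih hl'
    apply Subtype.ext
    simp only [finalQueue, List.map_append, List.foldl_append, List.map_cons, List.map_nil,
      List.foldl_cons, List.foldl_nil] at h1 ⊢
    rw [h1]
    exact φ.act_store _ v σ fun j hj hadj =>
      hl v j hadj ⟨by simp, List.mem_append_left _ hj⟩

/-- The sequence of single arrivals underlying a sequence of pairs of arrivals. -/
def unpair {β : Type*} (x : List (β × β)) : List β := x.flatMap fun a => [a.1, a.2]

theorem foldl_evenStep_val (x : List ((V × Prefs G) × (V × Prefs G))) (s : EvenQueue G) :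
    (x.foldl φ.evenStep s).1 = (unpair x).foldl φ.act s.1 := by
  induction x generalizing s with
  | nil => rfl
  | cons a x ih => rw [List.foldl_cons, ih]; rfl

theorem evenContent_eq_foldl (Y : InputPath G → EvenQueue G) (n : ℕ)
    (ω : InputPath G) : φ.evenContent Y n ω = (window 0 n ω).foldl φ.evenStep (Y ω) := by
  induction n with
  | zero => simp [window, evenContent]
  | succ n ih => rw [evenContent, ih, window_succ]; simp

theorem returnTime_eq_firstReturn (ω : InputPath G) :
    φ.returnTime (fun _ => EvenQueue.empty) ω = firstReturn φ.evenStep EvenQueue.empty ω := by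
  simp only [returnTime, firstReturn, evenContent_eq_foldl]

variable {φ}

/-- Sub-additivity, for arbitrary initial even queues. -/
theorem SubAdditive.length_foldl_evenStep_le (hφ : φ.SubAdditive) (s : EvenQueue G)
    (x : List ((V × Prefs G) × (V × Prefs G)))
    (hx : ∀ a ∈ x, a.1.2 ∈ φ.prefLaw.support ∧ a.2.2 ∈ φ.prefLaw.support) :
    (x.foldl φ.evenStep s).length ≤ s.length + (x.foldl φ.evenStep EvenQueue.empty).length := by
  obtain ⟨σ, hσ⟩ := φ.prefLaw.support_nonempty
  have h := hφ (s.1.1.map fun v => (v, σ)) (unpair x)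
    (by intro p hp; obtain ⟨v, -, rfl⟩ := List.mem_map.1 hp; exact hσ)
    (by
      intro p hp
      obtain ⟨a, ha, hp⟩ := List.mem_flatMap.1 hp
      have := hx a ha
      simp only [List.mem_cons, List.not_mem_nil, or_false] at hp
      rcases hp with rfl | rfl
      exacts [this.1, this.2])
  have h1 := φ.finalQueue_map_prod s.1 σ
  rw [finalQueue, List.foldl_append] at h
  rw [h1, finalQueue] at h
  rw [finalQueue] at h1
  rw [h1] at h
  unfold EvenQueue.length
  rw [foldl_evenStep_val, foldl_evenStep_val]
  exact h

/-! ### Shortening the queue by arrivals of edges -/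

variable (φ)

/-- The arrival of the two ends of an edge, with a common list of preferences. -/
def edgeInput (σ : Prefs G) (p : V × V) : (V × Prefs G) × (V × Prefs G) := ((p.1, σ), (p.2, σ))

theorem evenStep_edgeInput (σ : Prefs G) (s : EvenQueue G) {a c d : V} (ha : a ∈ s.1.1)
    (hca : G.Adj c a) :
    (φ.evenStep s (edgeInput σ (c, d))).length < s.length ∨
      ∃ j l, G.Adj c j ∧ (j :: l).Perm s.1.1 ∧
        (φ.evenStep s (edgeInput σ (c, d))).1.1.Perm (d :: l) := by
  obtain ⟨j, hj, hp⟩ := φ.exists_cons_act_perm s.1 c σ ⟨a, ha, hca⟩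
  by_cases h : ∃ i ∈ (φ.act s.1 (c, σ)).1, G.Adj d i
  · left
    obtain ⟨i, -, hp'⟩ := φ.exists_cons_act_perm _ d σ h
    have h1 := hp.length_eq
    have h2 := hp'.length_eq
    simp only [List.length_cons] at h1 h2
    unfold EvenQueue.length QueueDetail.length evenStep edgeInput
    dsimp only
    omega
  · right
    refine ⟨j, _, hj, hp, ?_⟩
    unfold evenStep edgeInput
    dsimp only
    rw [φ.act_store _ d σ fun i hi ha => h ⟨i, hi, ha⟩]
    exact List.perm_append_singleton _ _

theorem evenStep_empty_edgeInput (σ : Prefs G) {p : V × V} (h : G.Adj p.1 p.2) :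
    φ.evenStep EvenQueue.empty (edgeInput σ p) = EvenQueue.empty := by
  have h1 : (φ.act (QueueDetail.empty : QueueDetail G) (p.1, σ)).1 = [p.1] :=
    φ.act_store _ p.1 σ (by simp [QueueDetail.empty])
  obtain ⟨j, -, hp⟩ := φ.exists_cons_act_perm (φ.act (QueueDetail.empty : QueueDetail G) (p.1, σ))
    p.2 σ ⟨p.1, by simp [h1], h.symm⟩
  rw [h1] at hp
  have := hp.length_eq
  exact EvenQueue.ext (List.length_eq_zero_iff.1 (Nat.succ_injective this))

/-- If two stored items are joined by a walk of length `2 * k + 1`, at most `k` arrivals of edges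
make the queue shorter, whatever the policy.

If `a, c, d, …, b` is the walk, the arrival of `(c, d)` either shortens the queue or replaces a
stored neighbour of `c` by `d`; unless this neighbour is `b`, an odd walk shorter by two is left.
The same holds from the other end. In the remaining case `a` is adjacent to the neighbour of `b` on
the walk, and after the arrival of `(c, d)` the stored items `d` and `a` are joined by an odd
walk shorter by two. -/
theorem exists_edges_length_lt (σ : Prefs G) (k : ℕ) (s : EvenQueue G) {a b : V} {l : List V}
    (hs : s.1.1.Perm (a :: b :: l)) (p : G.Walk a b) (hp : p.length = 2 * k + 1) :
    ∃ E : List (V × V), E.length ≤ k ∧ (∀ x ∈ E, G.Adj x.1 x.2) ∧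
      ((E.map (edgeInput σ)).foldl φ.evenStep s).length < s.length := by
  induction k generalizing s a b l with
  | zero =>
    have hab : G.Adj a b := SimpleGraph.Walk.adj_of_length_eq_one (by simpa using hp)
    exact absurd ⟨hs.mem_iff.2 (by simp), hs.mem_iff.2 (by simp)⟩ (s.1.2 a b hab)
  | succ k ih =>
    -- one arrival of an edge, after which a shorter walk is available
    have step : ∀ {c d a' b' : V} {l' : List V}, G.Adj c d →
        (φ.evenStep s (edgeInput σ (c, d))).1.1.Perm (a' :: b' :: l') →
        (φ.evenStep s (edgeInput σ (c, d))).length = s.length →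
        ∀ q : G.Walk a' b', q.length = 2 * k + 1 →
        ∃ E : List (V × V), E.length ≤ k + 1 ∧ (∀ x ∈ E, G.Adj x.1 x.2) ∧
          ((E.map (edgeInput σ)).foldl φ.evenStep s).length < s.length := by
      intro c d a' b' l' hcd hperm hlen q hq
      obtain ⟨E, h1, h2, h3⟩ := ih _ hperm q hq
      refine ⟨(c, d) :: E, by simpa using h1, ?_, ?_⟩
      · intro x hx
        rcases List.mem_cons.1 hx with rfl | hx
        exacts [hcd, h2 x hx]
      · rw [List.map_cons, List.foldl_cons]
        exact h3.trans_eq hlen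
    have drop : ∀ {c d : V}, G.Adj c d →
        (φ.evenStep s (edgeInput σ (c, d))).length < s.length →
        ∃ E : List (V × V), E.length ≤ k + 1 ∧ (∀ x ∈ E, G.Adj x.1 x.2) ∧
          ((E.map (edgeInput σ)).foldl φ.evenStep s).length < s.length := by
      intro c d hcd hlt
      exact ⟨[(c, d)], by simp, by simpa using hcd, by simpa using hlt⟩
    have hlen : ∀ {c d j : V} {l' : List V}, (j :: l').Perm s.1.1 →
        (φ.evenStep s (edgeInput σ (c, d))).1.1.Perm (d :: l') →
        (φ.evenStep s (edgeInput σ (c, d))).length = s.length := by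
      intro c d j l' h1 h2
      exact h2.length_eq.trans h1.length_eq
    -- the walk `a, c, d, …, c'`, followed by the edge from `c'` to `b`
    obtain ⟨c, d, hac, hcd, q, hq⟩ : ∃ c d, ∃ (_ : G.Adj a c) (_ : G.Adj c d),
        ∃ q : G.Walk d b, q.length = 2 * k + 1 := by
      cases p with
      | nil => simp at hp
      | cons h1 p =>
        cases p with
        | nil => simp at hp
        | cons h2 q => exact ⟨_, _, h1, h2, q, by simp at hp; omega⟩
    obtain ⟨c', q', hcb, hq'⟩ : ∃ c', ∃ (q' : G.Walk d c') (_ : G.Adj c' b),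
        q'.length = 2 * k := by
      cases q with
      | nil => simp at hq
      | cons h q =>
        obtain ⟨x, r, hr, he⟩ := SimpleGraph.Walk.exists_cons_eq_concat h q
        refine ⟨x, r, hr, ?_⟩
        have := congrArg SimpleGraph.Walk.length he
        simp at this hq
        omega
    obtain ⟨d', hd', r, hr⟩ : ∃ d', ∃ (_ : G.Adj d' c') (r : G.Walk a d'),
        r.length = 2 * k + 1 := by
      obtain ⟨x, r, hr, he⟩ := SimpleGraph.Walk.exists_cons_eq_concat hac (SimpleGraph.Walk.cons hcd q')
      refine ⟨x, hr, r, ?_⟩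
      have := congrArg SimpleGraph.Walk.length he
      simp at this
      omega
    rcases φ.evenStep_edgeInput σ s (d := d) (hs.mem_iff.2 (by simp : a ∈ _)) hac.symm with
      h | ⟨j, l₁, hj, hp₁, hr₁⟩
    · exact drop hcd h
    by_cases hjb : j = b ∧ b ≠ a
    · rcases φ.evenStep_edgeInput σ s (d := d') (hs.mem_iff.2 (by simp : b ∈ _)) hcb with
        h | ⟨i, l₂, hi, hp₂, hr₂⟩
      · exact drop hd'.symm h
      by_cases hia : i = a
      · -- `a` is adjacent to `c'`, and the arrival of `(c, d)` replaces `b` by `d`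
        subst hia
        obtain ⟨rfl, hne⟩ := hjb
        have hmem : i ∈ l₁ := by
          have : i ∈ j :: l₁ := hp₁.mem_iff.2 (hs.mem_iff.2 (by simp))
          simpa [Ne.symm hne] using this
        obtain ⟨l₃, h₃⟩ : ∃ l₃, l₁.Perm (i :: l₃) := by
          classical
          exact ⟨_, List.perm_cons_erase hmem⟩
        exact step hcd (hr₁.trans (h₃.cons d)) (hlen hp₁ hr₁) (q'.concat hi) (by simp [hq'])
      · have hmem : a ∈ l₂ := by
          have : a ∈ i :: l₂ := hp₂.mem_iff.2 (hs.mem_iff.2 (by simp))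
          simpa [Ne.symm hia] using this
        obtain ⟨l₃, h₃⟩ : ∃ l₃, l₂.Perm (a :: l₃) := by
          classical
          exact ⟨_, List.perm_cons_erase hmem⟩
        exact step hd'.symm (hr₂.trans (h₃.cons d')) (hlen hp₂ hr₂) r.reverse (by simp [hr])
    · have hmem : b ∈ l₁ := by
        have h1 := hp₁.trans hs
        by_cases hja : j = a
        · subst hja
          exact (List.perm_cons j).1 h1 |>.mem_iff.2 (by simp)
        · have h2 : b ∈ j :: l₁ := h1.mem_iff.2 (by simp)
          rcases List.mem_cons.1 h2 with h | h
          · exact absurd ⟨h.symm, fun hba => hja (h.symm.trans hba)⟩ hjb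
          · exact h
      obtain ⟨l₃, h₃⟩ : ∃ l₃, l₁.Perm (b :: l₃) := by
        classical
        exact ⟨_, List.perm_cons_erase hmem⟩
      exact step hcd (hr₁.trans (h₃.cons d)) (hlen hp₁ hr₁) q hq

end MatchingPolicy

/-- In a connected graph that is not bipartite, any two vertices are joined by an odd walk. -/
theorem exists_odd_walk (hG : G.Connected) (h2 : ¬ G.Colorable 2) (a b : V) :
    ∃ (k : ℕ) (p : G.Walk a b), p.length = 2 * k + 1 := by
  rw [SimpleGraph.two_colorable_iff_forall_loop_even] at h2
  push Not at h2
  obtain ⟨u, c, hc⟩ := h2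
  rw [Nat.not_even_iff_odd] at hc
  obtain ⟨p⟩ := hG.preconnected a u
  obtain ⟨q⟩ := hG.preconnected u b
  by_cases h : Odd (p.append q).length
  · obtain ⟨k, hk⟩ := h
    exact ⟨k, _, hk⟩
  · have : Odd (p.append (c.append q)).length := by
      rw [Nat.not_odd_iff_even] at h
      simp only [SimpleGraph.Walk.length_append] at h ⊢
      rw [add_left_comm]
      exact hc.add_even h
    obtain ⟨k, hk⟩ := this
    exact ⟨k, _, hk⟩

/-! ### The shift -/

theorem shift_add (k l : ℤ) (ω : InputPath G) : shift k (shift l ω) = shift (k + l) ω := by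
  funext n
  simp [shift, add_assoc]

theorem shift_zero (ω : InputPath G) : shift 0 ω = ω := by
  funext n
  simp [shift]

theorem iterate_shift (k : ℤ) (n : ℕ) (ω : InputPath G) : (shift k)^[n] ω = shift (n * k) ω := by
  induction n with
  | zero => simp [shift_zero]
  | succ n ih =>
    rw [Function.iterate_succ_apply', ih, shift_add]
    congr 1
    push_cast
    ring

theorem window_shift (k l : ℤ) (n : ℕ) (ω : InputPath G) :
    window k n (shift l ω) = window (k + l) n ω := by
  simp only [window, shift]
  congr 1
  funext i
  congr 1
  ring

theorem measurePreserving_shift [MeasurableSpace V] (φ : MatchingPolicy G) (μ : PMF V) (k : ℤ) :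
    MeasurePreserving (shift k : InputPath G → InputPath G) (φ.inputLaw μ) (φ.inputLaw μ) := by
  have hm : Measurable (shift k : InputPath G → InputPath G) :=
    measurable_pi_lambda _ fun n => measurable_pi_apply _
  refine ⟨hm, ?_⟩
  have h := Measure.infinitePi_map_piCongrLeft (fun _ : ℤ => (φ.itemLaw μ).prod (φ.itemLaw μ))
    (Equiv.subRight k)
  have he : (shift k : InputPath G → InputPath G) =
      MeasurableEquiv.piCongrLeft (fun _ : ℤ => (V × Prefs G) × (V × Prefs G))
        (Equiv.subRight k) := by
    funext ω n
    obtain ⟨j, rfl⟩ := (Equiv.subRight k).surjective n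
    rw [MeasurableEquiv.coe_piCongrLeft, Equiv.piCongrLeft_apply_apply]
    simp [shift]
  rw [he]
  exact h

/-- Along almost every path, a stationary solution at time `0` is the content at time `0` of the
system started at time `-n` from the value of the solution at that time. -/
theorem MatchingPolicy.IsStationarySolution.ae_eq_foldl [MeasurableSpace V]
    {φ : MatchingPolicy G} {μ : PMF V} {U : InputPath G → EvenQueue G}
    (hU : φ.IsStationarySolution μ U) :
    ∀ᵐ ω ∂(φ.inputLaw μ), ∀ n : ℕ,
      U ω = (window (-n) n ω).foldl φ.evenStep (U (shift (-n) ω)) := by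
  have h : ∀ᵐ ω ∂(φ.inputLaw μ), ∀ k : ℤ,
      U (shift 1 (shift k ω)) = φ.evenStep (U (shift k ω)) (shift k ω 0) :=
    ae_all_iff.2 fun k => (measurePreserving_shift φ μ k).quasiMeasurePreserving.ae hU.2
  filter_upwards [h] with ω hω n
  have key : ∀ j : ℕ, U (shift (-n + j) ω) =
      (window (-n) j ω).foldl φ.evenStep (U (shift (-n) ω)) := by
    intro j
    induction j with
    | zero => simp [window]
    | succ j ih =>
      have := hω (-n + j)
      rw [shift_add, ih] at this
      rw [window_succ, List.foldl_append, List.foldl_cons, List.foldl_nil]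
      rw [show (-n + (j + 1 : ℕ) : ℤ) = 1 + (-n + j) by push_cast; ring, this]
      simp [shift]
  have := key n
  rwa [neg_add_cancel, shift_zero] at this

/-- The eventual value of a sequence of random variables in a countable discrete space can be
chosen measurable. -/
theorem exists_measurable_eq_of_eventually_eq {Ω S : Type*} [MeasurableSpace Ω]
    [MeasurableSpace S] [DiscreteMeasurableSpace S] [Countable S] [Nonempty S] {D : ℕ → Ω → S}
    (hD : ∀ n, Measurable (D n)) :
    ∃ U : Ω → S, Measurable U ∧ ∀ ω u, (∀ᶠ n in Filter.atTop, D n ω = u) → U ω = u := by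
  classical
  obtain ⟨d⟩ := ‹Nonempty S›
  let P : Ω → S → Prop := fun ω u => ∀ᶠ n in Filter.atTop, D n ω = u
  have huniq : ∀ ω u u', P ω u → P ω u' → u = u' := by
    intro ω u u' h h'
    obtain ⟨n, hn, hn'⟩ := (h.and h').exists
    exact hn.symm.trans hn'
  have hP : ∀ u, MeasurableSet {ω | P ω u} := by
    intro u
    have : {ω | P ω u} = ⋃ N : ℕ, ⋂ n : ℕ, ⋂ _ : N ≤ n, D n ⁻¹' {u} := by
      ext ω
      simp [P, Filter.eventually_atTop]
    rw [this]
    exact MeasurableSet.iUnion fun N => MeasurableSet.iInter fun n => MeasurableSet.iInter fun _ =>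
      hD n (MeasurableSet.of_discrete)
  let U : Ω → S := fun ω => if h : ∃ u, P ω u then h.choose else d
  have hU : ∀ ω u, P ω u → U ω = u := by
    intro ω u hu
    have h : ∃ u, P ω u := ⟨u, hu⟩
    simp only [U, dif_pos h]
    exact huniq ω _ _ h.choose_spec hu
  refine ⟨U, measurable_to_countable' fun u => ?_, hU⟩
  have : U ⁻¹' {u} = {ω | P ω u} ∪ ((⋃ u', {ω | P ω u'})ᶜ ∩ {_ω | u = d}) := by
    ext ω
    simp only [Set.mem_preimage, Set.mem_singleton_iff, Set.mem_union, Set.mem_ofPred_eq,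
      Set.mem_inter_iff, Set.mem_compl_iff, Set.mem_iUnion]
    by_cases h : ∃ u, P ω u
    · obtain ⟨u', hu'⟩ := h
      rw [hU ω u' hu']
      constructor
      · rintro rfl; exact Or.inl hu'
      · rintro (h | ⟨h, -⟩)
        · exact huniq ω _ _ hu' h
        · exact absurd ⟨u', hu'⟩ h
    · have hd : U ω = d := by simp only [U, dif_neg h]
      rw [hd]
      constructor
      · rintro rfl; exact Or.inr ⟨h, rfl⟩
      · rintro (h' | ⟨-, h'⟩)
        · exact absurd ⟨u, h'⟩ h
        · exact h'.symm
  rw [this]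
  exact (hP u).union ((MeasurableSet.iUnion hP).compl.inter (MeasurableSet.const _))

/-! ### The law of the input -/

section InputLaw

namespace MatchingPolicy

variable [MeasurableSpace V] (φ : MatchingPolicy G) (μ : PMF V)

/-- Law of a pair of arrivals. -/
abbrev pairLaw : Measure ((V × Prefs G) × (V × Prefs G)) :=
  (φ.itemLaw μ).prod (φ.itemLaw μ)

theorem ReturnIntegrable.lintegral_firstReturn_ne_top {φ : MatchingPolicy G} {μ : PMF V}
    (h : φ.ReturnIntegrable μ) :
    ∫⁻ ω, (firstReturn φ.evenStep EvenQueue.empty ω : ℝ≥0∞)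
      ∂(Measure.infinitePi fun _ : ℤ => φ.pairLaw μ) ≠ ∞ := by
  have h' := h
  unfold ReturnIntegrable at h'
  simp only [returnTime_eq_firstReturn] at h'
  exact h'

variable [Finite V] [DiscreteMeasurableSpace V]

theorem pairLaw_singleton (a : (V × Prefs G) × (V × Prefs G)) :
    φ.pairLaw μ {a} =
      (μ a.1.1 * φ.prefLaw a.1.2) * (μ a.2.1 * φ.prefLaw a.2.2) := by
  obtain ⟨⟨v, σ⟩, ⟨v', σ'⟩⟩ := a
  have h : ∀ (v : V) (σ : Prefs G), φ.itemLaw μ {(v, σ)} = μ v * φ.prefLaw σ := by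
    intro v σ
    rw [itemLaw, ← Set.singleton_prod_singleton, Measure.prod_prod,
      PMF.toMeasure_apply_singleton _ _ (measurableSet_singleton _),
      PMF.toMeasure_apply_singleton _ _ (measurableSet_singleton _)]
  rw [pairLaw, ← Set.singleton_prod_singleton, Measure.prod_prod, h, h]

variable {φ μ}

/-- An input of positive weight that takes the empty system back to the empty state does not
lengthen any queue. -/
theorem SubAdditive.length_foldl_le_of_foldl_empty (hφ : φ.SubAdditive) (s : EvenQueue G)
    (x : List ((V × Prefs G) × (V × Prefs G))) (hx : wt (fun a => φ.pairLaw μ {a}) x ≠ 0)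
    (he : x.foldl φ.evenStep EvenQueue.empty = EvenQueue.empty) :
    (x.foldl φ.evenStep s).length ≤ s.length := by
  have h := hφ.length_foldl_evenStep_le s x ?_
  · rwa [he, EvenQueue.eq_empty_iff.1 rfl, add_zero] at h
  · intro a ha
    have h0 : φ.pairLaw μ {a} ≠ 0 := by
      intro h0
      exact hx (List.prod_eq_zero (List.mem_map.2 ⟨a, ha, h0⟩))
    rw [pairLaw_singleton] at h0
    simp only [mul_ne_zero_iff] at h0
    exact ⟨h0.1.2, h0.2.2⟩

theorem pairLaw_edgeInput_ne_zero (hμ : ∀ v : V, v ∈ μ.support) {σ : Prefs G}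
    (hσ : σ ∈ φ.prefLaw.support) (p : V × V) : φ.pairLaw μ {edgeInput σ p} ≠ 0 := by
  rw [pairLaw_singleton]
  exact mul_ne_zero (mul_ne_zero (hμ _) hσ) (mul_ne_zero (hμ _) hσ)

end MatchingPolicy

end InputLaw

theorem exists_ne_zero_forall_le {α : Type*} [Finite α] (f : α → ℝ≥0∞) :
    ∃ δ : ℝ≥0∞, δ ≠ 0 ∧ ∀ a, f a ≠ 0 → δ ≤ f a := by
  refine ⟨⨅ a : {a // f a ≠ 0}, f a.1, ?_, fun a ha => iInf_le_of_le ⟨a, ha⟩ le_rfl⟩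
  rcases isEmpty_or_nonempty {a // f a ≠ 0} with h | h
  · simp [iInf_of_empty]
  · obtain ⟨a, ha⟩ := exists_eq_ciInf_of_finite (f := fun a : {a // f a ≠ 0} => f a.1)
    rw [← ha]
    exact a.2

theorem pow_length_le_wt {α : Type*} {q : α → ℝ≥0∞} {δ : ℝ≥0∞} (x : List α)
    (h : ∀ a ∈ x, δ ≤ q a) : δ ^ x.length ≤ wt q x := by
  induction x with
  | nil => simp
  | cons a x ih =>
    rw [List.length_cons, pow_succ', wt_cons]
    exact mul_le_mul' (h a (by simp)) (ih fun b hb => h b (List.mem_cons_of_mem _ hb))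

/-! ### Coalescence of queues -/

section Policy

variable [Finite V] [MeasurableSpace V] [DiscreteMeasurableSpace V]
  {φ : MatchingPolicy G} {μ : PMF V}

namespace MatchingPolicy

/-- From every nonempty queue, a sequence of `K` edges, of probability at least `δ`, makes the
queue shorter. -/
theorem SubAdditive.exists_block (hφ : φ.SubAdditive) (hG : G.Connected)
    (h2 : ¬ G.Colorable 2) (hμ : ∀ v : V, v ∈ μ.support) :
    ∃ K : ℕ, 0 < K ∧ ∃ δ : ℝ≥0∞, δ ≠ 0 ∧ ∀ s : EvenQueue G, s ≠ EvenQueue.empty →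
      ∃ v : Fin K → (V × Prefs G) × (V × Prefs G),
        (∀ i, φ.evenStep EvenQueue.empty (v i) = EvenQueue.empty) ∧
        δ ≤ wt (fun a => φ.pairLaw μ {a}) (List.ofFn v) ∧
        ((List.ofFn v).foldl φ.evenStep s).length < s.length := by
  obtain ⟨σ, hσ⟩ := φ.prefLaw.support_nonempty
  choose k hk using fun p : V × V => exists_odd_walk hG h2 p.1 p.2
  obtain ⟨K, hK⟩ : ∃ K, ∀ p, k p ≤ K := by
    obtain ⟨K, hK⟩ := (Set.finite_range k).bddAbove
    exact ⟨K, fun p => hK (Set.mem_range_self p)⟩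
  obtain ⟨δ, hδ, hmin⟩ := exists_ne_zero_forall_le
    fun p : V × V => φ.pairLaw μ {edgeInput σ p}
  refine ⟨K + 1, K.succ_pos, δ ^ (K + 1), pow_ne_zero _ hδ, fun s hs => ?_⟩
  obtain ⟨a, b, l, hsl⟩ : ∃ a b l, s.1.1 = a :: b :: l := by
    have h0 : s.1.1.length ≠ 0 := fun h => hs (EvenQueue.eq_empty_iff.2 h)
    have he : Even s.1.1.length := s.2
    match h : s.1.1 with
    | [] => simp [h] at h0
    | [a] => simp [h] at he
    | a :: b :: l => exact ⟨a, b, l, rfl⟩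
  obtain ⟨p, hp⟩ := hk (a, b)
  obtain ⟨E, hE, hadj, hlt⟩ := φ.exists_edges_length_lt σ (k (a, b)) s (List.Perm.of_eq hsl) p hp
  obtain ⟨y, hy⟩ : ∃ y, y ∈ E := by
    refine List.exists_mem_of_ne_nil E ?_
    rintro rfl
    simp at hlt
  -- padding with further arrivals of edges does not lengthen the queue
  set E' := E ++ List.replicate (K + 1 - E.length) y with hE'
  have hadj' : ∀ x ∈ E', G.Adj x.1 x.2 := by
    intro x hx
    rcases List.mem_append.1 hx with hx | hx
    · exact hadj x hx
    · rw [List.eq_of_mem_replicate hx]; exact hadj y hy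
  have hlen : (E'.map (edgeInput σ)).length = K + 1 := by
    have := hK (a, b)
    simp only [hE', List.length_map, List.length_append, List.length_replicate]
    omega
  obtain ⟨v, hv⟩ : ∃ v : Fin (K + 1) → (V × Prefs G) × (V × Prefs G),
      List.ofFn v = E'.map (edgeInput σ) := by
    rw [← hlen]
    exact ⟨_, List.ofFn_get _⟩
  refine ⟨v, fun i => ?_, ?_, ?_⟩
  · have : v i ∈ E'.map (edgeInput σ) := by rw [← hv]; exact List.mem_ofFn.2 ⟨i, rfl⟩
    obtain ⟨x, hx, hxv⟩ := List.mem_map.1 this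
    rw [← hxv]
    exact φ.evenStep_empty_edgeInput σ (hadj' x hx)
  · rw [hv, ← hlen]
    refine pow_length_le_wt _ fun a ha => ?_
    obtain ⟨x, hx, rfl⟩ := List.mem_map.1 ha
    exact hmin x (pairLaw_edgeInput_ne_zero hμ hσ x)
  · rw [hv, hE', List.map_append, List.foldl_append]
    refine lt_of_le_of_lt (hφ.length_foldl_evenStep_le _ _ ?_) ?_
    · intro a ha
      obtain ⟨x, hx, rfl⟩ := List.mem_map.1 ha
      exact ⟨hσ, hσ⟩
    · have : ((List.replicate (K + 1 - E.length) y).map (edgeInput σ)).foldl φ.evenStep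
          EvenQueue.empty = EvenQueue.empty := by
        rw [List.map_replicate]
        generalize K + 1 - E.length = n
        induction n with
        | zero => rfl
        | succ n ih =>
          rw [List.replicate_succ, List.foldl_cons,
            φ.evenStep_empty_edgeInput σ (hadj y hy), ih]
      rw [this, EvenQueue.eq_empty_iff.1 rfl, add_zero]
      exact hlt

/-- On a bipartite graph, the numbers of stored items of the two colours differ by a random walk
with independent increments, whose return time has infinite mean. -/
theorem ReturnIntegrable.not_colorable_two [Nonempty V] (h : φ.ReturnIntegrable μ)
    (hμ : ∀ v : V, v ∈ μ.support) : ¬ G.Colorable 2 := by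
  rintro ⟨C⟩
  obtain ⟨σ, hσ⟩ := φ.prefLaw.support_nonempty
  let c : V → ℤ := fun v => if C v = 0 then 1 else -1
  have hc : ∀ v j, G.Adj v j → c v + c j = 0 := by
    intro v j hvj
    have := C.valid hvj
    simp only [c]
    split_ifs <;> first | rfl | omega
  have hact : ∀ (w : QueueDetail G) (p : V × Prefs G),
      ((φ.act w p).1.map c).sum = (w.1.map c).sum + c p.1 := by
    rintro w ⟨v, σ⟩
    by_cases hw : ∃ j ∈ w.1, G.Adj v j
    · obtain ⟨j, hj, hp⟩ := φ.exists_cons_act_perm w v σ hw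
      have h1 := (hp.map c).sum_eq
      rw [List.map_cons, List.sum_cons] at h1
      linarith [hc v j hj]
    · rw [φ.act_store w v σ fun j hj ha => hw ⟨j, hj, ha⟩]
      simp
  let ξ : (V × Prefs G) × (V × Prefs G) → ℤ := fun a => c a.1.1 + c a.2.1
  have hsum : ∀ (x : List ((V × Prefs G) × (V × Prefs G))) (s : EvenQueue G),
      ((x.foldl φ.evenStep s).1.1.map c).sum = (s.1.1.map c).sum + (x.map ξ).sum := by
    intro x
    induction x with
    | nil => simp
    | cons a x ih =>
      intro s
      rw [List.foldl_cons, ih]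
      simp only [evenStep, hact, List.map_cons, List.sum_cons, ξ]
      ring
  obtain ⟨v⟩ := ‹Nonempty V›
  have h0 := increment_eq_zero_of_tsum_isExcursion_ne_top (φ.pairLaw μ)
    (ne_top_of_le_ne_top h.lintegral_firstReturn_ne_top (tsum_isExcursion_wt_le _)) ξ
    (fun x hx => by
      have := hsum x EvenQueue.empty
      rw [hx] at this
      simpa using this) (edgeInput σ (v, v)) (pairLaw_edgeInput_ne_zero hμ hσ _)
  simp only [ξ, c, edgeInput] at h0
  split_ifs at h0 <;> omega

/-- Almost surely, all the systems started far enough in the past from a queue of length at most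
`R` have the same content at time `0`. -/
theorem SubAdditive.ae_coalescence (hφ : φ.SubAdditive) (hG : G.Connected)
    (hμ : ∀ v : V, v ∈ μ.support) (h : φ.ReturnIntegrable μ) (R : ℕ) :
    ∀ᵐ ω ∂(φ.inputLaw μ), ∃ (N : ℕ) (u : EvenQueue G), ∀ n, N ≤ n → ∀ s : EvenQueue G,
      s.length ≤ R → (window (-n) n ω).foldl φ.evenStep s = u := by
  have := hG.nonempty
  obtain ⟨K, hK, δ, hδ, hdrop⟩ := hφ.exists_block hG (h.not_colorable_two hμ) hμ
  exact ae_exists_foldl_window_eq (φ.pairLaw μ) (len := EvenQueue.length) φ.length_evenStep_le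
    EvenQueue.finite_length_le (EvenQueue.eq_empty_iff.1 rfl)
    (fun s x hx he => hφ.length_foldl_le_of_foldl_empty s x hx he) hK hδ hdrop
    h.lintegral_firstReturn_ne_top R

end MatchingPolicy

end Policy

end StochasticMatching

end

/-! ### Stationary solution -/

open StochasticMatching

theorem theorem1 {V : Type*} [Finite V] [MeasurableSpace V] [DiscreteMeasurableSpace V]
    (G : SimpleGraph V) (hG : G.Connected)
    (μ : PMF V) (hμ : ∀ v : V, v ∈ μ.support)
    (φ : StochasticMatching.MatchingPolicy G) (hφ : φ.SubAdditive)
    (hH1 : φ.ReturnIntegrable μ) :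
    ∃ U : StochasticMatching.InputPath G → StochasticMatching.EvenQueue G,
      φ.IsStationarySolution μ U ∧
      (∀ U' : StochasticMatching.InputPath G → StochasticMatching.EvenQueue G,
        φ.IsStationarySolution μ U' → U' =ᵐ[φ.inputLaw μ] U) ∧
      (∀ Y : StochasticMatching.InputPath G → StochasticMatching.EvenQueue G,
        Measurable Y → (∃ r : ℕ, ∀ᵐ ω ∂(φ.inputLaw μ), (Y ω).length ≤ 2 * r) →
          φ.StrongBackwardsCoupling μ Y U) := by
  have hco := hφ.ae_coalescence hG hμ hH1
  have hempty : (EvenQueue.empty : EvenQueue G).length = 0 := EvenQueue.eq_empty_iff.1 rfl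
  have : Nonempty (EvenQueue G) := ⟨EvenQueue.empty⟩
  -- `U` is the eventual content at time `0` of the systems started empty in the past
  obtain ⟨U, hUm, hU⟩ := exists_measurable_eq_of_eventually_eq
    (D := fun (n : ℕ) (ω : InputPath G) => (window (-n) n ω).foldl φ.evenStep EvenQueue.empty)
    fun n => measurable_comp_window _ n fun x => x.foldl φ.evenStep EvenQueue.empty
  have hco' : ∀ᵐ ω ∂(φ.inputLaw μ), ∀ R : ℕ, ∃ N : ℕ, ∀ n, N ≤ n → ∀ s : EvenQueue G,
      s.length ≤ R → (window (-n) n ω).foldl φ.evenStep s = U ω := by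
    filter_upwards [ae_all_iff.2 hco] with ω hω R
    obtain ⟨N, u, h⟩ := hω R
    have : U ω = u := hU ω u (Filter.eventually_atTop.2
      ⟨N, fun n hn => h n hn _ (by rw [hempty]; exact Nat.zero_le _)⟩)
    exact ⟨N, this ▸ h⟩
  refine ⟨U, ⟨hUm, ?_⟩, fun U' hU' => ?_, fun Y _ hY => ?_⟩
  · filter_upwards [hco'] with ω hω
    obtain ⟨N, h⟩ := hω 0
    refine hU _ _ (Filter.eventually_atTop.2 ⟨N + 1, fun n hn => ?_⟩)
    obtain ⟨n, rfl⟩ : ∃ k, n = k + 1 := ⟨n - 1, by omega⟩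
    rw [window_shift, show (-(n + 1 : ℕ) + 1 : ℤ) = -n by push_cast; ring, window_succ,
      List.foldl_append, h n (by omega) _ hempty.le]
    simp
  · -- by recurrence, the solution is infinitely often in the past as short as at time `0`
    have hrec : ∀ᵐ ω ∂(φ.inputLaw μ), ∀ R : ℕ, (U' ω).length ≤ R →
        ∃ᶠ n : ℕ in Filter.atTop, (U' (shift (-n) ω)).length ≤ R := by
      have : IsProbabilityMeasure (φ.inputLaw μ) := by
        unfold MatchingPolicy.inputLaw; infer_instance
      refine ae_all_iff.2 fun R => ?_
      have hs : MeasurableSet {ω : InputPath G | (U' ω).length ≤ R} :=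
        hU'.1 (MeasurableSet.of_discrete (s := {s : EvenQueue G | s.length ≤ R}))
      filter_upwards [(measurePreserving_shift φ μ (-1)).conservative.ae_mem_imp_frequently_image_mem
        hs.nullMeasurableSet] with ω hω hR
      refine (hω hR).mono fun n hn => ?_
      rw [iterate_shift, mul_neg_one] at hn
      exact hn
    filter_upwards [hco', hrec, hU'.ae_eq_foldl] with ω h1 h2 h3
    obtain ⟨N, hN⟩ := h1 (U' ω).length
    obtain ⟨n, hn, hle⟩ := Filter.frequently_atTop.1 (h2 _ le_rfl) N
    rw [h3 n]
    exact hN n hn _ hle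
  · obtain ⟨r, hr⟩ := hY
    have hr' : ∀ᵐ ω ∂(φ.inputLaw μ), ∀ n : ℕ, (Y (shift (-n) ω)).length ≤ 2 * r :=
      ae_all_iff.2 fun n => (measurePreserving_shift φ μ (-n)).quasiMeasurePreserving.ae hr
    filter_upwards [hco', hr'] with ω h1 h2
    obtain ⟨N, hN⟩ := h1 (2 * r)
    refine ⟨N, fun n hn => ?_⟩
    rw [MatchingPolicy.evenContent_eq_foldl, window_shift, zero_add]
    exact hN n hn _ (h2 n)
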